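/- Let $d\ge 1$, $\lambda>0$ and $n\ge 1$. Let $B=\{x\in\mathbb R^d:\|x\|\le1\}$, let $S=\{x:\|x\|=1\}$ with surface measure $d\omega$, and let $\omega_d=\int_S d\omega$. For real polynomials $f,g$ in $d$ variables put $$\langle f,g\rangle_{\mathrm I}=\frac{\lambda}{\omega_d}\int_B\nabla f\cdot\nabla g\,dx+\frac1{\omega_d}\int_S fg\,d\omega,\qquad \langle f,g\rangle_{\mathrm{II}}=\frac{\lambda}{\omega_d}\int_B\nabla f\cdot\nabla g\,dx+f(0)g(0).$$ Let $\mathcal V_n^d(\mathrm{II})$ be the space of polynomials of degree at most $n$ that are orthogonal with respect to $\langle\cdot,\cdot\rangle_{\mathrm{II}}$ to all polynomials of degree less than $n$. Let $\mathcal H_m^d$ be the space of harmonic polynomials homogeneous of degree $m$, let $\sigma_m=\dim\mathcal H_m^d$, and for each $m$ let $\{Y_\nu^m:1\le\nu\le\sigma_m\}$ be a basis of $\mathcal H_m^d$ that is orthonormal for $\frac1{\omega_d}\int_S fg\,d\omega$. Write $(a)_k=a(a+1)\cdots(a+k-1)$ and, for real $\alpha,\beta$, let $$P_k^{(\alpha,\beta)}(x)=\frac1{k!}\sum_{i=0}^k\binom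 ki(k+\alpha+\beta+1)_i(\alpha+i+1)_{k-i}\Bigl(\frac{x-1}2\Bigr)^i$$ be the Jacobi polynomials. Put $$U_{0,\nu}^n=Y_\nu^n,\qquad U_{j,\nu}^n(x)=(1-\|x\|^2)\,P_{j-1}^{(1,\,n-2j+\frac{d-2}2)}(2\|x\|^2-1)\,Y_\nu^{n-2j}(x)\quad(1\le j\le n/2).$$ **Theorem.** A mutually orthogonal basis $\{V_{j,\nu}^n:0\le j\le \frac n2,\ 1\le\nu\le\sigma_{n-2j}\}$ of $\mathcal V_n^d(\mathrm{II})$ is given by $$V_{j,\nu}^n=U_{j,\nu}^n\quad\text{for } 0\le j\le\lfloor\tfrac{n-1}2\rfloor,$$ together with, when $n$ is even, the single radial element (here $\sigma_0=1$, and $\nu$ is dropped) $$V_{n/2}^n(x)=\frac{4}{n+d-2}\left(P_{n/2}^{(-1,\frac{d-2}2)}(2\|x\|^2-1)-(-1)^{n/2}\frac{(d/2)_{n/2}}{(n/2)!}\right).$$ Furthermore, $$\langle V_{j,\nu}^n,V_{j,\nu}^n\rangle_{\mathrm{II}}=\langle U_{j,\nu}^n,U_{j,\nu}^n\rangle_{\mathrm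 I}\quad\text{for }1\le j\le\lfloor\tfrac{n-1}2\rfloor,\qquad \langle V_{0,\nu}^n,V_{0,\nu}^n\rangle_{\mathrm{II}}=n\lambda,$$ and, for $n$ even, $$\langle V_{n/2}^n,V_{n/2}^n\rangle_{\mathrm{II}}=\frac{8\lambda}{n+\frac{d-2}2}.$$ -/

import Mathlib

noncomputable section

namespace SobolevBall

open MeasureTheory

/-- The ring `ℝ[x₁, …, x_d]` of real polynomials in `d` variables. -/
abbrev Poly (d : ℕ) : Type := MvPolynomial (Fin d) ℝ

/-- The value `f(x)` of a polynomial at a point of Euclidean space. -/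
def evalAt {d : ℕ} (x : EuclideanSpace ℝ (Fin d)) (f : Poly d) : ℝ :=
  MvPolynomial.eval (fun i => x i) f

/-- The surface measure `dω` on the unit sphere of `ℝ^d`. -/
def sphereMeasure (d : ℕ) : Measure (Metric.sphere (0 : EuclideanSpace ℝ (Fin d)) 1) :=
  (volume : Measure (EuclideanSpace ℝ (Fin d))).toSphere

/-- The area `ω_d = ∫ dω` of the unit sphere. -/
def sphereArea (d : ℕ) : ℝ := (sphereMeasure d).real Set.univ

/-- The function `x ↦ ∇f(x) · ∇g(x)`. -/
def gradDot {d : ℕ} (f g : Poly d) (x : EuclideanSpace ℝ (Fin d)) : ℝ :=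
  ∑ i : Fin d, evalAt x (MvPolynomial.pderiv i f) * evalAt x (MvPolynomial.pderiv i g)

/-- `∫_B ∇f · ∇g dx` over the closed unit ball `B`. -/
def gradIntegral {d : ℕ} (f g : Poly d) : ℝ :=
  ∫ x in Metric.closedBall (0 : EuclideanSpace ℝ (Fin d)) 1, gradDot f g x

/-- The normalized inner product `(1/ω_d) ∫_S f g dω` on the unit sphere `S`. -/
def sphereInner {d : ℕ} (f g : Poly d) : ℝ :=
  (1 / sphereArea d) *
    ∫ y : Metric.sphere (0 : EuclideanSpace ℝ (Fin d)) 1,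
      evalAt y.1 f * evalAt y.1 g ∂(sphereMeasure d)

/-- `⟨f, g⟩_I = (lam/ω_d) ∫_B ∇f · ∇g dx + (1/ω_d) ∫_S f g dω`. -/
def innerI {d : ℕ} (lam : ℝ) (f g : Poly d) : ℝ :=
  lam / sphereArea d * gradIntegral f g + sphereInner f g

/-- `⟨f, g⟩_II = (lam/ω_d) ∫_B ∇f · ∇g dx + f(0) g(0)`. -/
def innerII {d : ℕ} (lam : ℝ) (f g : Poly d) : ℝ :=
  lam / sphereArea d * gradIntegral f g + evalAt 0 f * evalAt 0 g

theorem continuous_evalAt {d : ℕ} (f : Poly d) :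
    Continuous fun x : EuclideanSpace ℝ (Fin d) => evalAt x f := by
  unfold evalAt
  exact (MvPolynomial.continuous_eval f).comp (by fun_prop)

theorem integrableOn_gradDot {d : ℕ} (f g : Poly d) :
    IntegrableOn (gradDot f g) (Metric.closedBall (0 : EuclideanSpace ℝ (Fin d)) 1) := by
  apply ContinuousOn.integrableOn_compact (isCompact_closedBall _ _)
  apply Continuous.continuousOn
  unfold gradDot
  exact continuous_finsetSum _ fun i _ => (continuous_evalAt _).mul (continuous_evalAt _)

theorem innerII_add_left {d : ℕ} (lam : ℝ) (f g h : Poly d) :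
    innerII lam (f + g) h = innerII lam f h + innerII lam g h := by
  have key : gradIntegral (f + g) h = gradIntegral f h + gradIntegral g h := by
    unfold gradIntegral
    rw [← integral_add (integrableOn_gradDot f h) (integrableOn_gradDot g h)]
    congr 1
    funext x
    simp [gradDot, evalAt, add_mul, Finset.sum_add_distrib]
  simp only [innerII, key, evalAt, map_add]
  ring

theorem innerII_smul_left {d : ℕ} (lam c : ℝ) (f h : Poly d) :
    innerII lam (c • f) h = c * innerII lam f h := by
  have key : gradIntegral (c • f) h = c * gradIntegral f h := by
    unfold gradIntegral
    rw [← integral_const_mul]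
    congr 1
    funext x
    simp [gradDot, evalAt, Finset.mul_sum, mul_assoc]
  simp only [innerII, key, evalAt, MvPolynomial.smul_eval]
  ring

/-- The space `𝒱_n^d(II)`: the polynomials of degree at most `n` that are orthogonal, with respect
to `⟨·,·⟩_II`, to every polynomial of degree less than `n`. -/
def orthogonalSpaceII (d : ℕ) (lam : ℝ) (n : ℕ) : Submodule ℝ (Poly d) where
  carrier := {P | P.totalDegree ≤ n ∧ ∀ Q : Poly d, Q.totalDegree < n → innerII lam P Q = 0}
  zero_mem' := by
    refine ⟨by simp, fun Q _ => ?_⟩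
    simpa using innerII_smul_left lam 0 (0 : Poly d) Q
  add_mem' := by
    rintro P R ⟨hP, hP0⟩ ⟨hR, hR0⟩
    refine ⟨(MvPolynomial.totalDegree_add P R).trans (max_le hP hR), fun Q hQ => ?_⟩
    rw [innerII_add_left, hP0 Q hQ, hR0 Q hQ, add_zero]
  smul_mem' := by
    rintro c P ⟨hP, hP0⟩
    refine ⟨(MvPolynomial.totalDegree_smul_le c P).trans hP, fun Q hQ => ?_⟩
    rw [innerII_smul_left, hP0 Q hQ, mul_zero]

/-- The Laplace operator `Δ = ∑ ∂²/∂x_i²` on polynomials. -/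
def laplacian (d : ℕ) : Poly d →ₗ[ℝ] Poly d :=
  ∑ i : Fin d, (MvPolynomial.pderiv i).toLinearMap ∘ₗ (MvPolynomial.pderiv i).toLinearMap

/-- The space `ℋ_m^d` of harmonic polynomials that are homogeneous of degree `m`. -/
def harmonicSpace (d m : ℕ) : Submodule ℝ (Poly d) :=
  MvPolynomial.homogeneousSubmodule (Fin d) ℝ m ⊓ LinearMap.ker (laplacian d)

/-- `σ_m = dim ℋ_m^d`. -/
def harmonicDim (d m : ℕ) : ℕ := Module.finrank ℝ (harmonicSpace d m)

/-- `Y_1, …, Y_{σ_m}` is a basis of `ℋ_m^d`, orthonormal for the normalized surface measure on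
the unit sphere (linear independence follows from orthonormality). -/
structure IsOrthonormalHarmonicBasis (d m : ℕ) (Y : Fin (harmonicDim d m) → Poly d) : Prop where
  span_eq : Submodule.span ℝ (Set.range Y) = harmonicSpace d m
  orthonormal : ∀ μ ν, sphereInner (Y μ) (Y ν) = if μ = ν then 1 else 0

/-- The Jacobi polynomial `P_k^{(α,β)}`, for all real parameters, in the usual normalization
`P_k^{(α,β)}(x) = (1/k!) ∑_{i ≤ k} C(k,i) (k+α+β+1)_i (α+i+1)_{k-i} ((x-1)/2)^i`. -/
def jacobi (k : ℕ) (α β : ℝ) : Polynomial ℝ :=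
  ∑ i ∈ Finset.range (k + 1),
    Polynomial.C ((k.choose i : ℝ) * (ascPochhammer ℝ i).eval (k + α + β + 1)
        * (ascPochhammer ℝ (k - i)).eval (α + i + 1) / (k.factorial : ℝ))
      * (Polynomial.C (1 / 2) * (Polynomial.X - 1)) ^ i

/-- The polynomial `‖x‖² = ∑ x_i²`. -/
def normSq (d : ℕ) : Poly d := ∑ i : Fin d, MvPolynomial.X i ^ 2

/-- The polynomial `q(2‖x‖² - 1)`, for a polynomial `q` in one variable. -/
def radial (d : ℕ) (q : Polynomial ℝ) : Poly d := Polynomial.aeval (2 * normSq d - 1) q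

/-- `U_{j,ν}^n`, where `y` stands for `Y_ν^{n-2j}`. -/
def polyU {d : ℕ} (n j : ℕ) (y : Poly d) : Poly d :=
  if j = 0 then y
  else (1 - normSq d) * radial d (jacobi (j - 1) 1 ((n : ℝ) - 2 * j + ((d : ℝ) - 2) / 2)) * y

/-- The radial element `V_{n/2}^n` (for even `n`). -/
def radialV (d n : ℕ) : Poly d :=
  MvPolynomial.C (4 / ((n : ℝ) + d - 2)) *
    (radial d (jacobi (n / 2) (-1) (((d : ℝ) - 2) / 2))
      - MvPolynomial.C ((-1) ^ (n / 2) * (ascPochhammer ℝ (n / 2)).eval ((d : ℝ) / 2)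
          / ((n / 2).factorial : ℝ)))

/-- The index set `{(j, ν) : 0 ≤ j ≤ n/2, 1 ≤ ν ≤ σ_{n-2j}}`. -/
abbrev BasisIndex (d n : ℕ) : Type :=
  (j : Fin (n / 2 + 1)) × Fin (harmonicDim d (n - 2 * (j : ℕ)))

/-- The family `V_{j,ν}^n`: it is `U_{j,ν}^n` for `2j < n`, that is for `j ≤ ⌊(n-1)/2⌋`, and the
radial element for `2j = n`. -/
def basisII {d : ℕ} (Y : ∀ m : ℕ, Fin (harmonicDim d m) → Poly d) (n : ℕ) (a : BasisIndex d n) :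
    Poly d :=
  if 2 * (a.1 : ℕ) < n then polyU n a.1 (Y (n - 2 * (a.1 : ℕ)) a.2) else radialV d n

end SobolevBall

end

/-! ### One variable: Pochhammer symbols, Jacobi polynomials and moments on [0,1]. -/

noncomputable section
namespace SobolevBall
open Polynomial

/-! Every basis element has the form p(‖x‖²) y with y a homogeneous harmonic of degree m = n - 2j
and p of exact degree j. On such products the Dirichlet integral separates: pairing with q(‖x‖²) z
gives zero unless the harmonic degrees agree, and otherwise ∫_S yz dω times m p(1)q(1) + 2 ∫₀¹
s^{m+d/2} p'(s)q'(s) ds (`gradIntegral_radial`). For j ≥ 1 the boundary term disappears, because p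
contains 1 - s or because m = 0, and p' is a nonzero multiple of P_{j-1}^{(0,γ)}(2s-1) with γ = m +
d/2 (`derivative_radialPart`). These are the orthogonal polynomials for s^γ on [0,1], so the
gradient part is orthogonal to lower degrees and its norm is explicit.

The point evaluation f(0)g(0) plays no role: for m ≥ 1 the factor y vanishes at 0, and the constant
subtracted in the radial element makes it vanish there too (`evalAt_zero_basisII`).

Modulo lower degree the elements are nonzero multiples of ‖x‖^{2j} y, and these span all homogeneous
polynomials of degree n (`mem_of_isHomogeneous`). Since the form is definite
(`eq_zero_of_innerII_self`), a member of the orthogonal space differs from a combination of the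
basis by something orthogonal to itself, hence zero.

The sphere integrals of harmonics come from Gaussian integrals: integration by parts over the whole
space has no boundary term, and homogeneity makes the Gaussian and sphere integrals proportional. -/

theorem poch_succ_left (k : ℕ) (a : ℝ) :
    (ascPochhammer ℝ (k + 1)).eval a = a * (ascPochhammer ℝ k).eval (a + 1) := by
  simp [ascPochhammer_succ_left]

theorem poch_add (n m : ℕ) (a : ℝ) :
    (ascPochhammer ℝ (n + m)).eval a =
      (ascPochhammer ℝ n).eval a * (ascPochhammer ℝ m).eval (a + n) := by
  simp [← ascPochhammer_mul]

theorem poch_nat_factorial (i k : ℕ) :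
    (i.factorial : ℝ) * (ascPochhammer ℝ k).eval ((i : ℝ) + 1) = ((i + k).factorial : ℝ) := by
  have h := Nat.factorial_mul_ascFactorial i k
  rw [← h, Nat.cast_mul, ← ascPochhammer_nat_eq_ascFactorial, ascPochhammer_eval_cast]
  push_cast; rfl

/-- The Chu–Vandermonde identity. -/
theorem chu_vandermonde (k : ℕ) (a c : ℝ) :
    ∑ i ∈ Finset.range (k + 1), (-1) ^ i * (k.choose i : ℝ) * (ascPochhammer ℝ i).eval a *
      (ascPochhammer ℝ (k - i)).eval (c + i) = (ascPochhammer ℝ k).eval (c - a) := by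
  induction k generalizing a c with
  | zero => simp
  | succ k ih =>
    -- Pascal's rule splits the sum in two. In this half the last Pochhammer factor is (c + i) + (k
    -- - i) = c + k, independent of i; in `h2` the first factor a comes out.
    have h1 : ∑ i ∈ Finset.range (k + 1), (-1) ^ i * (k.choose i : ℝ) *
        (ascPochhammer ℝ i).eval a * (ascPochhammer ℝ (k + 1 - i)).eval (c + i) =
        (c + k) * (ascPochhammer ℝ k).eval (c - a) := by
      rw [← ih, Finset.mul_sum]
      refine Finset.sum_congr rfl fun i hi => ?_
      have hi : i ≤ k := Nat.lt_succ_iff.1 (Finset.mem_range.1 hi)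
      rw [Nat.sub_add_comm hi, ascPochhammer_succ_eval, Nat.cast_sub hi]
      ring
    have h2 : ∑ i ∈ Finset.range (k + 1), (-1) ^ (i + 1) * (k.choose i : ℝ) *
        (ascPochhammer ℝ (i + 1)).eval a * (ascPochhammer ℝ (k - i)).eval (c + (i + 1 : ℕ)) =
        - a * (ascPochhammer ℝ k).eval (c - a) := by
      have := ih (a + 1) (c + 1)
      rw [show c + 1 - (a + 1) = c - a by ring] at this
      rw [← this, Finset.mul_sum]
      refine Finset.sum_congr rfl fun i _ => ?_
      rw [poch_succ_left, show c + ((i + 1 : ℕ) : ℝ) = c + 1 + i by push_cast; ring]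
      ring
    rw [ascPochhammer_succ_eval, show (ascPochhammer ℝ k).eval (c - a) * (c - a + k) =
      (c + k) * (ascPochhammer ℝ k).eval (c - a) + -a * (ascPochhammer ℝ k).eval (c - a) by ring,
      ← h1, ← h2, Finset.sum_range_succ' _ (k + 1)]
    conv_rhs => rw [Finset.sum_range_succ' _ k]
    have h3 : ∑ i ∈ Finset.range (k + 1), (-1) ^ (i + 1) * (k.choose (i + 1) : ℝ) *
        (ascPochhammer ℝ (i + 1)).eval a *
          (ascPochhammer ℝ (k + 1 - (i + 1))).eval (c + (i + 1 : ℕ)) =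
        ∑ i ∈ Finset.range k, (-1) ^ (i + 1) * (k.choose (i + 1) : ℝ) *
        (ascPochhammer ℝ (i + 1)).eval a *
          (ascPochhammer ℝ (k + 1 - (i + 1))).eval (c + (i + 1 : ℕ)) := by
      rw [Finset.sum_range_succ]; simp
    rw [← h3, add_right_comm, ← Finset.sum_add_distrib]
    congr 1
    · refine Finset.sum_congr rfl fun i _ => ?_
      rw [Nat.choose_succ_succ, Nat.add_sub_add_right]
      push_cast; ring
    · simp

/-- The polynomial `P_k^{(0,γ)}(2s - 1)`. -/
def shiftedJacobi (k : ℕ) (γ : ℝ) : ℝ[X] :=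
  ∑ i ∈ Finset.range (k + 1),
    C ((k.choose i : ℝ) * (ascPochhammer ℝ i).eval (k + γ + 1) / (i.factorial : ℝ)) * (X - 1) ^ i

/-- The linear functional `p ↦ ∫₀¹ s^γ p(s) ds`. -/
def moment (γ : ℝ) : ℝ[X] →ₗ[ℝ] ℝ :=
  Polynomial.lsum fun i => (1 / ((i : ℝ) + γ + 1)) • LinearMap.id

theorem moment_monomial (γ : ℝ) (i : ℕ) (c : ℝ) :
    moment γ (monomial i c) = c / (i + γ + 1) := by
  simp [moment, Polynomial.sum_monomial_index]
  ring

theorem moment_X_pow (γ : ℝ) (i : ℕ) : moment γ (X ^ i) = 1 / (i + γ + 1) := by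
  rw [← monomial_one_right_eq_X_pow, moment_monomial]

theorem moment_C_mul (γ c : ℝ) (p : ℝ[X]) : moment γ (C c * p) = c * moment γ p := by
  rw [← smul_eq_C_mul, map_smul, smul_eq_mul]

/-- This is the Beta integral, obtained by peeling off one factor X - 1 at a time. -/
theorem moment_X_pow_mul_X_sub_one_pow {γ : ℝ} (hγ : -1 < γ) (b i : ℕ) :
    moment γ (X ^ b * (X - 1) ^ i) =
      (-1) ^ i * i.factorial / (ascPochhammer ℝ (i + 1)).eval (γ + b + 1) := by
  induction i generalizing b with
  | zero => simp [moment_X_pow]; ring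
  | succ i ih =>
    have e : (X ^ b * (X - 1) ^ (i + 1) : ℝ[X]) =
        X ^ (b + 1) * (X - 1) ^ i - X ^ b * (X - 1) ^ i := by ring
    have hb : (0 : ℝ) ≤ b := b.cast_nonneg
    have hi : (0 : ℝ) ≤ i := i.cast_nonneg
    have h1 : 0 < (ascPochhammer ℝ i).eval (γ + b + 1 + 1) := ascPochhammer_pos _ _ (by linarith)
    rw [e, map_sub, ih, ih, poch_succ_left (i + 1), poch_succ_left i (γ + b + 1),
      ascPochhammer_succ_eval i (γ + (b + 1 : ℕ) + 1),
      ascPochhammer_succ_eval i (γ + b + 1 + 1),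
      show γ + ((b + 1 : ℕ) : ℝ) + 1 = γ + b + 1 + 1 by push_cast; ring, Nat.factorial_succ]
    have h2 : γ + b + 1 ≠ 0 := by linarith
    have h3 : γ + b + 1 + 1 + i ≠ 0 := by linarith
    have h1' := h1.ne'
    field_simp
    push_cast
    ring

/-- Termwise Beta integrals turn the left side into a Chu–Vandermonde sum. The numerator (b+1-k)_k
contains the factor 0 when b < k, which is the source of orthogonality. -/
theorem moment_X_pow_mul_shiftedJacobi {γ : ℝ} (hγ : -1 < γ) (b k : ℕ) :
    moment γ (X ^ b * shiftedJacobi k γ) =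
      (ascPochhammer ℝ k).eval ((b : ℝ) + 1 - k) /
        (ascPochhammer ℝ (k + 1)).eval (γ + b + 1) := by
  have h := chu_vandermonde k (k + γ + 1) (γ + b + 2)
  have hb : (0 : ℝ) ≤ b := b.cast_nonneg
  rw [show (b : ℝ) + 1 - k = γ + b + 2 - (k + γ + 1) by ring, ← h, shiftedJacobi, Finset.mul_sum,
    map_sum, Finset.sum_div]
  refine Finset.sum_congr rfl fun i hi => ?_
  have hi : i ≤ k := Nat.lt_succ_iff.1 (Finset.mem_range.1 hi)
  rw [mul_left_comm, moment_C_mul, moment_X_pow_mul_X_sub_one_pow hγ,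
    show k + 1 = (i + 1) + (k - i) by lia, poch_add (i + 1),
    show γ + b + 1 + ((i + 1 : ℕ) : ℝ) = γ + b + 2 + i by push_cast; ring]
  have h1 : 0 < (ascPochhammer ℝ (i + 1)).eval (γ + b + 1) := ascPochhammer_pos _ _ (by linarith)
  have h2 : 0 < (ascPochhammer ℝ (k - i)).eval (γ + b + 2 + i) :=
    ascPochhammer_pos _ _ (by linarith [(i.cast_nonneg : (0 : ℝ) ≤ i)])
  have h3 : (i.factorial : ℝ) ≠ 0 := by positivity
  have h1' := h1.ne'
  have h2' := h2.ne'
  field_simp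

theorem moment_mul_shiftedJacobi {γ : ℝ} (hγ : -1 < γ) {k : ℕ} {q : ℝ[X]} (hq : q.degree < k) :
    moment γ (q * shiftedJacobi k γ) = 0 := by
  conv_lhs => rw [q.as_sum_support_C_mul_X_pow]
  rw [Finset.sum_mul, map_sum]
  refine Finset.sum_eq_zero fun i hi => ?_
  have hik : i < k := by
    have := (le_degree_of_mem_supp i hi).trans_lt hq
    exact_mod_cast this
  rw [mul_assoc, moment_C_mul, moment_X_pow_mul_shiftedJacobi hγ]
  have : (ascPochhammer ℝ k).eval ((i : ℝ) + 1 - k) = 0 := by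
    rw [show (i : ℝ) + 1 - k = -((k - 1 - i : ℕ) : ℝ) by
      rw [Nat.sub_sub, Nat.cast_sub (by lia)]; push_cast; ring]
    rw [ascPochhammer_eval_neg_coe_nat_of_lt]
    lia
  rw [this]; simp

theorem natDegree_X_sub_one_pow (i : ℕ) : ((X - 1 : ℝ[X]) ^ i).natDegree = i := by
  rw [← C_1, natDegree_pow, natDegree_X_sub_C, mul_one]

theorem natDegree_shiftedJacobi_le (k : ℕ) (γ : ℝ) : (shiftedJacobi k γ).natDegree ≤ k := by
  refine natDegree_sum_le_of_forall_le _ _ fun i hi => (natDegree_C_mul_le _ _).trans ?_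
  rw [natDegree_X_sub_one_pow]
  exact Nat.lt_succ_iff.1 (Finset.mem_range.1 hi)

theorem coeff_shiftedJacobi (k : ℕ) (γ : ℝ) : (shiftedJacobi k γ).coeff k =
    (ascPochhammer ℝ k).eval (k + γ + 1) / (k.factorial : ℝ) := by
  rw [shiftedJacobi, finsetSum_coeff, Finset.sum_range_succ, Finset.sum_eq_zero, coeff_C_mul]
  · have : ((X - 1 : ℝ[X]) ^ k).coeff k = 1 := by
      have h := (monic_X_sub_C (1 : ℝ)).pow k
      rw [C_1, Monic, leadingCoeff, natDegree_X_sub_one_pow] at h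
      exact h
    simp [this]
  · intro i hi
    rw [coeff_C_mul, coeff_eq_zero_of_natDegree_lt, mul_zero]
    rw [natDegree_X_sub_one_pow]
    exact Finset.mem_range.1 hi

theorem coeff_shiftedJacobi_pos (k : ℕ) {γ : ℝ} (hγ : -1 < γ) : 0 < (shiftedJacobi k γ).coeff k := by
  rw [coeff_shiftedJacobi]
  have := ascPochhammer_pos k ((k : ℝ) + γ + 1) (by linarith [(k.cast_nonneg : (0 : ℝ) ≤ k)])
  positivity

/-- By orthogonality one factor may be replaced by its leading term. -/
theorem moment_shiftedJacobi_sq (k : ℕ) {γ : ℝ} (hγ : -1 < γ) :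
    moment γ (shiftedJacobi k γ * shiftedJacobi k γ) = 1 / (2 * k + γ + 1) := by
  set c := (shiftedJacobi k γ).coeff k with hc
  have hk : (0 : ℝ) ≤ k := k.cast_nonneg
  have e : shiftedJacobi k γ * shiftedJacobi k γ =
      C c * (X ^ k * shiftedJacobi k γ) +
        (shiftedJacobi k γ - C c * X ^ k) * shiftedJacobi k γ := by ring
  have hdeg : (shiftedJacobi k γ - C c * X ^ k).degree < (k : WithBot ℕ) := by
    rw [degree_lt_iff_coeff_zero]
    intro m hm
    rw [coeff_sub, coeff_C_mul_X_pow]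
    split_ifs with h
    · rw [h, sub_self]
    · rw [coeff_eq_zero_of_natDegree_lt, sub_zero]
      exact (natDegree_shiftedJacobi_le k γ).trans_lt (by lia)
  rw [e, map_add, moment_mul_shiftedJacobi hγ hdeg, moment_C_mul,
    moment_X_pow_mul_shiftedJacobi hγ, hc, coeff_shiftedJacobi, add_zero,
    ascPochhammer_succ_eval]
  have h1 := (poch_nat_factorial 0 k)
  have h2 := (ascPochhammer_pos k ((k : ℝ) + γ + 1) (by linarith)).ne'
  have h3 : (k.factorial : ℝ) ≠ 0 := by positivity
  have h4 : γ + k + 1 + k ≠ 0 := by linarith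
  have h5 : 2 * (k : ℝ) + γ + 1 ≠ 0 := by linarith
  simp only [Nat.factorial_zero, Nat.cast_one, Nat.cast_zero, one_mul, zero_add] at h1
  rw [show (k : ℝ) + 1 - k = 1 by ring, h1, show γ + (k : ℝ) + 1 = k + γ + 1 by ring]
  rw [show γ + (k : ℝ) + 1 + k = 2 * k + γ + 1 by ring] at h4
  rw [show (k : ℝ) + γ + 1 + k = 2 * k + γ + 1 by ring]
  field_simp

theorem jacobi_comp (k : ℕ) (α β : ℝ) : (jacobi k α β).comp (2 * X - 1) =
    ∑ i ∈ Finset.range (k + 1),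
      C ((k.choose i : ℝ) * (ascPochhammer ℝ i).eval (k + α + β + 1)
        * (ascPochhammer ℝ (k - i)).eval (α + i + 1) / (k.factorial : ℝ)) * (X - 1) ^ i := by
  rw [jacobi, ← coe_compRingHom_apply, map_sum]
  refine Finset.sum_congr rfl fun i _ => ?_
  rw [coe_compRingHom_apply, mul_comp, C_comp, pow_comp, mul_comp, C_comp, sub_comp, X_comp, one_comp]
  congr 2
  have : (C (1 / 2) : ℝ[X]) * 2 = 1 := by
    rw [← C_ofNat, ← C_mul]; norm_num
  linear_combination (X - 1) * this

/-- Chu–Vandermonde followed by the reflection (-k-β)_k = (-1)^k (β+1)_k. This identifies the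
constant subtracted in the radial element. -/
theorem eval_jacobi_comp_zero (k : ℕ) (α β : ℝ) : ((jacobi k α β).comp (2 * X - 1)).eval 0 =
    (-1) ^ k * (ascPochhammer ℝ k).eval (β + 1) / (k.factorial : ℝ) := by
  have h := chu_vandermonde k (k + α + β + 1) (α + 1)
  rw [jacobi_comp, eval_finsetSum]
  have h4 : (ascPochhammer ℝ k).eval (α + 1 - (k + α + β + 1)) =
      (-1) ^ k * (ascPochhammer ℝ k).eval (β + 1) := by
    have h5 := ascPochhammer_eval_neg_eq_descPochhammer ℝ (k + β) k
    rw [descPochhammer_eval_eq_ascPochhammer] at h5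
    rw [show α + 1 - (k + α + β + 1) = -(k + β) by ring, h5]
    congr 2; ring
  rw [← h4, ← h, Finset.sum_div]
  refine Finset.sum_congr rfl fun i _ => ?_
  simp
  ring_nf

/-- Coefficients in powers of X - 1 match because (i+1)! (i+2)_{k-i} = (k+1)!. -/
theorem derivative_one_sub_mul_jacobi (k : ℕ) (β : ℝ) :
    derivative ((1 - X) * (jacobi k 1 β).comp (2 * X - 1)) =
      C (-((k : ℝ) + 1)) * shiftedJacobi k (β + 1) := by
  rw [jacobi_comp, shiftedJacobi, Finset.mul_sum, Finset.mul_sum, derivative_sum]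
  refine Finset.sum_congr rfl fun i hi => ?_
  have hi : i ≤ k := Nat.lt_succ_iff.1 (Finset.mem_range.1 hi)
  have e := poch_nat_factorial (i + 1) (k - i)
  rw [show i + 1 + (k - i) = k + 1 by lia] at e
  rw [show ∀ c : ℝ, (1 - X) * (C c * (X - 1) ^ i) = C (-c) * (X - 1 : ℝ[X]) ^ (i + 1) by
    intro c; rw [C_neg]; ring, derivative_C_mul, derivative_pow_succ]
  simp only [derivative_sub, derivative_X, derivative_one, sub_zero, mul_one]
  rw [← mul_assoc, ← mul_assoc, ← C_mul, ← C_mul]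
  congr 2
  have h3 : (i.factorial : ℝ) ≠ 0 := by positivity
  have h4 : (k.factorial : ℝ) ≠ 0 := by positivity
  rw [Nat.factorial_succ, Nat.factorial_succ k] at e
  push_cast at e
  rw [show (1 : ℝ) + i + 1 = i + 1 + 1 by ring, show (k : ℝ) + (β + 1) + 1 = k + 1 + β + 1 by ring]
  field_simp
  linear_combination -(k.choose i : ℝ) * (ascPochhammer ℝ i).eval (k + 1 + β + 1) * e

theorem derivative_jacobi_neg_one (k : ℕ) (β : ℝ) :
    derivative ((jacobi (k + 1) (-1) β).comp (2 * X - 1)) =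
      C ((k : ℝ) + 1 + β) * shiftedJacobi k (β + 1) := by
  rw [jacobi_comp, shiftedJacobi, Finset.mul_sum, derivative_sum, Finset.sum_range_succ']
  have h0 : derivative (C (((k + 1).choose 0 : ℝ) *
      (ascPochhammer ℝ 0).eval (((k + 1 : ℕ) : ℝ) + -1 + β + 1) *
      (ascPochhammer ℝ (k + 1 - 0)).eval (-1 + ((0 : ℕ) : ℝ) + 1) / ((k + 1).factorial : ℝ)) *
      (X - 1 : ℝ[X]) ^ 0) = 0 := by rw [pow_zero, mul_one, derivative_C]
  rw [h0, add_zero]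
  refine Finset.sum_congr rfl fun i hi => ?_
  have hi : i ≤ k := Nat.lt_succ_iff.1 (Finset.mem_range.1 hi)
  have e := poch_nat_factorial i (k - i)
  rw [show i + (k - i) = k by lia] at e
  have e2 : ((k : ℝ) + 1) * (k.choose i : ℝ) = ((k + 1).choose (i + 1) : ℝ) * (i + 1) := by
    exact_mod_cast Nat.add_one_mul_choose_eq k i
  rw [derivative_C_mul, derivative_pow_succ]
  simp only [derivative_sub, derivative_X, derivative_one, sub_zero, mul_one]
  rw [← mul_assoc, ← mul_assoc, ← C_mul, ← C_mul]
  congr 2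
  have h3 : (i.factorial : ℝ) ≠ 0 := by positivity
  have h4 : (k.factorial : ℝ) ≠ 0 := by positivity
  rw [Nat.factorial_succ, poch_succ_left, Nat.add_sub_add_right]
  push_cast
  rw [show (-1 : ℝ) + (i + 1) + 1 = i + 1 by ring,
    show (k : ℝ) + 1 + -1 + β + 1 = k + 1 + β by ring,
    show (k : ℝ) + (β + 1) + 1 = k + 1 + β + 1 by ring]
  field_simp
  rw [← e]
  linear_combination -(i.factorial : ℝ) * (k + 1 + β) * (ascPochhammer ℝ i).eval (k + 1 + β + 1) * (ascPochhammer ℝ (k - i)).eval (i + 1 : ℝ) * e2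

end SobolevBall
end

/-! ### Decomposition of polynomials into powers of ‖x‖² times harmonics. -/

noncomputable section
namespace SobolevBall
open MvPolynomial

variable {d : ℕ}

theorem laplacian_apply (f : Poly d) : laplacian d f = ∑ i, pderiv i (pderiv i f) := by
  simp [laplacian]

theorem pderiv_normSq (i : Fin d) : pderiv i (normSq d) = 2 * X i := by
  simp only [normSq, map_sum, pderiv_pow, pderiv_X]
  rw [Finset.sum_eq_single i]
  · simp
  · intro j _ hj
    simp [hj.symm]
  · simp

theorem isHomogeneous_normSq (d : ℕ) : (normSq d).IsHomogeneous 2 :=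
  IsHomogeneous.sum _ _ _ fun i _ => isHomogeneous_X_pow i 2

theorem _root_.MvPolynomial.IsHomogeneous.laplacian {f : Poly d} {n : ℕ} (hf : f.IsHomogeneous n) :
    (laplacian d f).IsHomogeneous (n - 2) := by
  rw [laplacian_apply]
  exact IsHomogeneous.sum _ _ _ fun i _ => hf.pderiv.pderiv

theorem pderiv_eq_zero_of_isHomogeneous_zero {f : Poly d} (hf : f.IsHomogeneous 0) (i : Fin d) :
    pderiv i f = 0 := by
  rw [← totalDegree_zero_iff_isHomogeneous, totalDegree_eq_zero_iff_eq_C] at hf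
  rw [hf, pderiv_C]

theorem laplacian_eq_zero_of_lt_two {f : Poly d} {n : ℕ} (hf : f.IsHomogeneous n) (hn : n < 2) :
    laplacian d f = 0 := by
  rw [laplacian_apply]
  refine Finset.sum_eq_zero fun i _ => pderiv_eq_zero_of_isHomogeneous_zero ?_ i
  have := hf.pderiv (i := i)
  rwa [show n - 1 = 0 by lia] at this

/-- The cross term of the product rule is 4 x·∇g, which Euler's identity evaluates. -/
theorem laplacian_normSq_mul {g : Poly d} {m : ℕ} (hg : g.IsHomogeneous m) :
    laplacian d (normSq d * g) = normSq d * laplacian d g + (4 * m + 2 * d : ℝ) • g := by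
  have euler : ∑ i, X i * pderiv i g = (m : Poly d) * g := by
    rw [hg.sum_X_mul_pderiv, nsmul_eq_mul]
  have key : ∀ i, pderiv i (pderiv i (normSq d * g)) =
      normSq d * pderiv i (pderiv i g) + 4 * (X i * pderiv i g) + 2 * g := by
    intro i
    simp only [pderiv_mul, pderiv_normSq, map_add, pderiv_X_self]
    have : pderiv i (2 : Poly d) = 0 := by
      rw [← map_ofNat C 2, pderiv_C]
    rw [this]; ring
  rw [laplacian_apply, laplacian_apply, Finset.sum_congr rfl fun i _ => key i,
    Finset.sum_add_distrib, Finset.sum_add_distrib, ← Finset.mul_sum, ← Finset.mul_sum, euler,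
    smul_eq_C_mul, map_add, map_mul, map_mul, map_ofNat, map_ofNat, map_natCast, map_natCast]
  simp
  ring

/-- The ansatz g = c⁻¹q + ‖x‖²u leaves an equation of the same kind for u, of degree n - 2 and with
the larger constant 4m + 2d + c, where m = n - 2. -/
theorem exists_normSq_mul_laplacian_add_smul_eq (n : ℕ) (c : ℝ) (hc : 0 < c) (q : Poly d)
    (hq : q.IsHomogeneous n) :
    ∃ g : Poly d, g.IsHomogeneous n ∧ normSq d * laplacian d g + c • g = q := by
  induction n using Nat.strong_induction_on generalizing c q with
  | _ n ih =>
    rcases lt_or_ge n 2 with hn | hn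
    · refine ⟨c⁻¹ • q, (homogeneousSubmodule _ _ n).smul_mem _ hq, ?_⟩
      rw [map_smul, laplacian_eq_zero_of_lt_two hq hn, smul_smul, mul_inv_cancel₀ hc.ne']
      simp
    · obtain ⟨m, rfl⟩ := Nat.exists_eq_add_of_le' hn
      have hq2 : (laplacian d q).IsHomogeneous m := hq.laplacian
      obtain ⟨u, hu, hu2⟩ := ih m (by lia) (4 * m + 2 * d + c) (by positivity)
        (-(c⁻¹ • laplacian d q)) (IsHomogeneous.neg
          ((homogeneousSubmodule _ _ m).smul_mem _ hq2))
      refine ⟨c⁻¹ • q + normSq d * u, ?_, ?_⟩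
      · refine IsHomogeneous.add ((homogeneousSubmodule _ _ (m + 2)).smul_mem _ hq) ?_
        rw [add_comm]
        exact (isHomogeneous_normSq d).mul hu
      · rw [map_add, map_smul, laplacian_normSq_mul hu, smul_add, smul_smul,
          mul_inv_cancel₀ hc.ne', one_smul]
        rw [add_smul] at hu2
        rw [← mul_smul_comm]
        linear_combination normSq d * hu2

/-- A homogeneous polynomial of degree `n` is a combination of products `‖x‖^{2j} h` with `h`
harmonic and homogeneous of degree `n - 2j`. -/
theorem mem_of_isHomogeneous (hd : 1 ≤ d) (W : Submodule ℝ (Poly d)) (n : ℕ)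
    (hW : ∀ j m : ℕ, 2 * j + m = n → ∀ h ∈ harmonicSpace d m, normSq d ^ j * h ∈ W)
    {f : Poly d} (hf : f.IsHomogeneous n) : f ∈ W := by
  induction n using Nat.strong_induction_on generalizing W f with
  | _ n ih =>
    rcases lt_or_ge n 2 with hn | hn
    · have := hW 0 n (by lia) f ⟨hf, laplacian_eq_zero_of_lt_two hf hn⟩
      simpa using this
    · obtain ⟨m, rfl⟩ := Nat.exists_eq_add_of_le' hn
      have hd' : (0 : ℝ) < d := by exact_mod_cast hd
      -- With this constant the equation reads Δ(‖x‖²g) = Δf, so f - ‖x‖²g is harmonic.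
      obtain ⟨g, hg, hg2⟩ := exists_normSq_mul_laplacian_add_smul_eq m (4 * m + 2 * d)
        (by positivity) (laplacian d f) hf.laplacian
      rw [← laplacian_normSq_mul hg] at hg2
      have h1 : f - normSq d * g ∈ W := by
        have := hW 0 (m + 2) (by lia) (f - normSq d * g) ⟨?_, ?_⟩
        · simpa using this
        · refine IsHomogeneous.sub hf ?_
          rw [add_comm]
          exact (isHomogeneous_normSq d).mul hg
        · exact LinearMap.mem_ker.2 (by rw [map_sub, hg2, sub_self])
      have h2 : g ∈ W.comap (LinearMap.mulLeft ℝ (normSq d)) := by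
        refine ih m (by lia) _ (fun j l hjl h hh => ?_) hg
        have := hW (j + 1) l (by lia) h hh
        simpa [pow_succ', mul_assoc] using this
      have := W.add_mem h1 h2
      simpa using this

theorem mem_of_totalDegree_lt (hd : 1 ≤ d) (W : Submodule ℝ (Poly d)) (n : ℕ)
    (hW : ∀ j m : ℕ, 2 * j + m < n → ∀ h ∈ harmonicSpace d m, normSq d ^ j * h ∈ W)
    {f : Poly d} (hf : f.totalDegree < n) : f ∈ W := by
  rw [← sum_homogeneousComponent f]
  refine W.sum_mem fun i hi => mem_of_isHomogeneous hd W i (fun j m hjm => hW j m ?_)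
    (homogeneousComponent_isHomogeneous i f)
  have := Finset.mem_range.1 hi
  lia

end SobolevBall
end

/-! ### Sphere and ball integrals in polar coordinates. -/

noncomputable section
namespace SobolevBall
open MeasureTheory Set MvPolynomial

variable {d : ℕ}

theorem evalAt_add (x : EuclideanSpace ℝ (Fin d)) (f g : Poly d) :
    evalAt x (f + g) = evalAt x f + evalAt x g := map_add _ _ _

theorem evalAt_mul (x : EuclideanSpace ℝ (Fin d)) (f g : Poly d) :
    evalAt x (f * g) = evalAt x f * evalAt x g := map_mul _ _ _

theorem evalAt_sum {ι : Type*} (s : Finset ι) (x : EuclideanSpace ℝ (Fin d)) (f : ι → Poly d) :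
    evalAt x (∑ i ∈ s, f i) = ∑ i ∈ s, evalAt x (f i) := map_sum _ _ _

theorem evalAt_C (x : EuclideanSpace ℝ (Fin d)) (c : ℝ) : evalAt x (C c) = c := eval_C _

theorem evalAt_smul (x : EuclideanSpace ℝ (Fin d)) (c : ℝ) (f : Poly d) :
    evalAt x (c • f) = c * evalAt x f := MvPolynomial.smul_eval _ _ _

theorem evalAt_normSq (x : EuclideanSpace ℝ (Fin d)) : evalAt x (normSq d) = ‖x‖ ^ 2 := by
  simp [evalAt, normSq, EuclideanSpace.real_norm_sq_eq]

theorem evalAt_smul_of_isHomogeneous {f : Poly d} {k : ℕ} (hf : f.IsHomogeneous k) (r : ℝ)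
    (x : EuclideanSpace ℝ (Fin d)) : evalAt (r • x) f = r ^ k * evalAt x f := by
  simp only [evalAt, eval_eq', Finset.mul_sum]
  refine Finset.sum_congr rfl fun m hm => ?_
  have hk : ∑ i, m i = k := by
    rw [← Finsupp.degree_eq_sum]; exact (hf.degree_eq_sum_deg_support hm).symm
  simp only [PiLp.smul_apply, smul_eq_mul, mul_pow, Finset.prod_mul_distrib,
    Finset.prod_pow_eq_pow_sum, hk]
  ring

/-- The integral of a polynomial over the unit sphere. -/
def sphereInt (f : Poly d) : ℝ :=
  ∫ y : Metric.sphere (0 : EuclideanSpace ℝ (Fin d)) 1, evalAt y.1 f ∂(sphereMeasure d)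

theorem sphereInt_normSq_mul (f : Poly d) : sphereInt (normSq d * f) = sphereInt f := by
  unfold sphereInt
  congr 1
  funext y
  rw [evalAt_mul, evalAt_normSq, norm_eq_of_mem_sphere]
  simp

theorem sphereInner_eq (f g : Poly d) :
    sphereInner f g = 1 / sphereArea d * sphereInt (f * g) := by
  simp only [sphereInner, sphereInt, evalAt_mul]

theorem sphereArea_pos (hd : 1 ≤ d) : 0 < sphereArea d := by
  have : Nonempty (Fin d) := ⟨⟨0, hd⟩⟩
  unfold sphereArea sphereMeasure
  rw [measureReal_def]
  refine ENNReal.toReal_pos ?_ (measure_ne_top _ _)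
  rw [Measure.measure_univ_ne_zero]
  exact Measure.toSphere_ne_zero _

/-- Integration in polar coordinates of a homogeneous polynomial against a radial weight. -/
theorem integral_radial_mul_evalAt (hd : 1 ≤ d) {f : Poly d} {k : ℕ} (hf : f.IsHomogeneous k)
    (φ : ℝ → ℝ) :
    ∫ x : EuclideanSpace ℝ (Fin d), φ ‖x‖ * evalAt x f =
      (∫ r in Ioi (0 : ℝ), r ^ (d - 1) * (φ r * r ^ k)) * sphereInt f := by
  have : Nonempty (Fin d) := ⟨⟨0, hd⟩⟩
  set μ : Measure (EuclideanSpace ℝ (Fin d)) := volume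
  calc
    ∫ x, φ ‖x‖ * evalAt x f ∂μ = ∫ x : ({(0)}ᶜ : Set (EuclideanSpace ℝ (Fin d))),
        φ ‖x.1‖ * evalAt x.1 f ∂(μ.comap (↑)) := by
      rw [integral_subtype_comap (measurableSet_singleton _).compl
        fun x => φ ‖x‖ * evalAt x f, restrict_compl_singleton]
    _ = ∫ x, evalAt x.1.1 f * (φ x.2 * (x.2 : ℝ) ^ k)
          ∂μ.toSphere.prod (.volumeIoiPow (d - 1)) := by
      have h := μ.measurePreserving_homeomorphUnitSphereProd.integral_comp
        (Homeomorph.measurableEmbedding _)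
        (fun x => evalAt x.1.1 f * (φ x.2 * (x.2 : ℝ) ^ k))
      rw [finrank_euclideanSpace_fin] at h
      rw [← h]
      congr 1
      funext x
      have hx : ‖x.1‖ ≠ 0 := norm_ne_zero_iff.2 x.2
      simp only [homeomorphUnitSphereProd_apply_snd_coe, homeomorphUnitSphereProd_apply_fst_coe]
      rw [evalAt_smul_of_isHomogeneous hf, inv_pow]
      field_simp
    _ = sphereInt f * ∫ x : Ioi (0 : ℝ), φ x * (x : ℝ) ^ k ∂.volumeIoiPow (d - 1) :=
      integral_prod_mul (fun y : Metric.sphere (0 : EuclideanSpace ℝ (Fin d)) 1 => evalAt y.1 f)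
        (fun r : Ioi (0 : ℝ) => φ r * (r : ℝ) ^ k)
    _ = _ := by
      rw [mul_comm]
      congr 1
      simp only [Measure.volumeIoiPow, ENNReal.ofReal]
      rw [integral_withDensity_eq_integral_smul,
        integral_subtype_comap measurableSet_Ioi
          fun a => Real.toNNReal (a ^ (d - 1)) • (φ a * a ^ k),
        setIntegral_congr_fun measurableSet_Ioi fun x hx => ?_]
      · rw [NNReal.smul_def, Real.coe_toNNReal _ (pow_nonneg hx.out.le _), smul_eq_mul]
      · exact (measurable_subtype_coe.pow_const _).real_toNNReal

/-- The integral of a polynomial over the unit ball. -/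
def ballInt (f : Poly d) : ℝ :=
  ∫ x in Metric.closedBall (0 : EuclideanSpace ℝ (Fin d)) 1, evalAt x f

theorem integrableOn_ball (f : Poly d) : IntegrableOn (fun x => evalAt x f)
    (Metric.closedBall (0 : EuclideanSpace ℝ (Fin d)) 1) :=
  (continuous_evalAt f).continuousOn.integrableOn_compact (isCompact_closedBall _ _)

/-- Polar coordinates with the indicator of r ≤ 1 as weight leave ∫₀¹ r^{k+d-1} dr. -/
theorem ballInt_of_isHomogeneous (hd : 1 ≤ d) {f : Poly d} {k : ℕ} (hf : f.IsHomogeneous k) :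
    ballInt f = sphereInt f / (k + d) := by
  have h := integral_radial_mul_evalAt hd hf ((Iic (1 : ℝ)).indicator 1)
  have h1 : ∫ r in Ioi (0 : ℝ), r ^ (d - 1) * ((Iic (1 : ℝ)).indicator 1 r * r ^ k) =
      1 / (k + d) := by
    have e : ∀ r : ℝ, r ^ (d - 1) * ((Iic (1 : ℝ)).indicator 1 r * r ^ k) =
        (Iic (1 : ℝ)).indicator (fun r => r ^ (k + d - 1)) r := by
      intro r
      by_cases hr : r ∈ Iic (1 : ℝ)
      · rw [indicator_of_mem hr, indicator_of_mem hr, Pi.one_apply, one_mul, ← pow_add]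
        congr 1; lia
      · rw [indicator_of_notMem hr, indicator_of_notMem hr]; ring
    simp_rw [e]
    rw [setIntegral_indicator measurableSet_Iic, Ioi_inter_Iic,
      ← intervalIntegral.integral_of_le zero_le_one, integral_pow]
    have : (((k + d - 1 : ℕ) : ℝ) + 1) = k + d := by
      have : k + d - 1 + 1 = k + d := by lia
      exact_mod_cast this
    rw [this, show k + d - 1 + 1 = k + d by lia, zero_pow (by lia), one_pow, sub_zero]
  rw [h1] at h
  rw [ballInt, ← integral_indicator Metric.isClosed_closedBall.measurableSet,
    div_eq_inv_mul, inv_eq_one_div, ← h]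
  congr 1
  funext x
  by_cases hx : x ∈ Metric.closedBall (0 : EuclideanSpace ℝ (Fin d)) 1
  · rw [indicator_of_mem hx, indicator_of_mem (by simpa using hx)]; simp
  · rw [indicator_of_notMem hx, indicator_of_notMem (by simpa using hx)]; simp

theorem hasFDerivAt_evalAt (f : Poly d) (x : EuclideanSpace ℝ (Fin d)) :
    HasFDerivAt (fun x => evalAt x f)
      (∑ i, evalAt x (pderiv i f) • (EuclideanSpace.proj i : EuclideanSpace ℝ (Fin d) →L[ℝ] ℝ)) x := by
  induction f using MvPolynomial.induction_on with
  | C a =>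
    simp only [evalAt_C, pderiv_C]
    have : ∑ i, evalAt x 0 • (EuclideanSpace.proj i : EuclideanSpace ℝ (Fin d) →L[ℝ] ℝ) = 0 := by
      simp [evalAt]
    rw [this]
    exact hasFDerivAt_const a x
  | add p q hp hq =>
    simp only [evalAt_add, map_add, add_smul, Finset.sum_add_distrib]
    exact hp.add hq
  | mul_X p n hp =>
    have hX : HasFDerivAt (fun x : EuclideanSpace ℝ (Fin d) => evalAt x (X n : Poly d))
        (EuclideanSpace.proj n : EuclideanSpace ℝ (Fin d) →L[ℝ] ℝ) x := by
      simpa [evalAt] using (EuclideanSpace.proj n : EuclideanSpace ℝ (Fin d) →L[ℝ] ℝ).hasFDerivAt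
    simp only [evalAt_mul]
    refine (hp.mul hX).congr_fderiv ?_
    simp only [pderiv_mul, evalAt_add, evalAt_mul, pderiv_X, add_smul, Finset.sum_add_distrib,
      Finset.smul_sum]
    rw [add_comm]
    congr 1
    · refine Finset.sum_congr rfl fun i _ => ?_
      rw [mul_comm, mul_smul]
    · rw [Finset.sum_eq_single n]
      · simp [evalAt]
      · intro j _ hj
        simp [evalAt, hj.symm]
      · simp

end SobolevBall
end

/-! ### Gaussian integration by parts and integrals of harmonics. -/

noncomputable section
namespace SobolevBall
open MeasureTheory Set MvPolynomial

variable {d : ℕ}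

theorem integrable_gauss (f : Poly d) :
    Integrable fun x : EuclideanSpace ℝ (Fin d) => Real.exp (-‖x‖ ^ 2) * evalAt x f := by
  have h1 : ∀ m : Fin d →₀ ℕ, Integrable fun x : Fin d → ℝ =>
      ∏ i, (x i ^ m i * Real.exp (-1 * x i ^ 2)) := by
    intro m
    refine Integrable.fintype_prod (f := fun i t => t ^ m i * Real.exp (-1 * t ^ 2)) fun i => ?_
    have := integrable_rpow_mul_exp_neg_mul_sq one_pos (s := (m i : ℝ))
      (by linarith [((m i).cast_nonneg : (0 : ℝ) ≤ m i)])
    simpa only [Real.rpow_natCast] using this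
  have h2 : ∀ m : Fin d →₀ ℕ, Integrable fun x : EuclideanSpace ℝ (Fin d) =>
      ∏ i, (x i ^ m i * Real.exp (-1 * x i ^ 2)) := fun m =>
    ((PiLp.volume_preserving_ofLp (Fin d)).integrable_comp (h1 m).aestronglyMeasurable).2 (h1 m)
  have h3 : (fun x : EuclideanSpace ℝ (Fin d) => Real.exp (-‖x‖ ^ 2) * evalAt x f) =
      fun x => ∑ m ∈ f.support, coeff m f * ∏ i, (x i ^ m i * Real.exp (-1 * x i ^ 2)) := by
    funext x
    simp only [evalAt, eval_eq', Finset.prod_mul_distrib, ← Real.exp_sum,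
      ← Finset.mul_sum, ← EuclideanSpace.real_norm_sq_eq]
    rw [Finset.mul_sum]
    refine Finset.sum_congr rfl fun m _ => ?_
    rw [neg_one_mul]; ring
  rw [h3]
  exact integrable_finsetSum _ fun m _ => (h2 m).const_mul _

/-- The Gaussian integral of a polynomial. -/
def gaussInt (f : Poly d) : ℝ :=
  ∫ x : EuclideanSpace ℝ (Fin d), Real.exp (-‖x‖ ^ 2) * evalAt x f

theorem gaussInt_smul (c : ℝ) (f : Poly d) : gaussInt (c • f) = c * gaussInt f := by
  unfold gaussInt
  rw [← integral_const_mul]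
  simp only [evalAt_smul, mul_left_comm]

theorem gaussInt_sum {ι : Type*} (s : Finset ι) (f : ι → Poly d) :
    gaussInt (∑ i ∈ s, f i) = ∑ i ∈ s, gaussInt (f i) := by
  unfold gaussInt
  rw [← integral_finsetSum _ fun i _ => integrable_gauss (f i)]
  simp only [evalAt_sum, Finset.mul_sum]

theorem sum_smul_proj_single (c : Fin d → ℝ) (i : Fin d) :
    (∑ j, c j • (EuclideanSpace.proj j : EuclideanSpace ℝ (Fin d) →L[ℝ] ℝ))
      (EuclideanSpace.single i 1) = c i := by
  simp

/-- Integration by parts: differentiating the Gaussian produces -2xᵢ, and its decay removes boundary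
terms. -/
theorem gaussInt_pderiv (f : Poly d) (i : Fin d) :
    gaussInt (pderiv i f) = 2 * gaussInt (X i * f) := by
  have hE : ∀ x : EuclideanSpace ℝ (Fin d), HasFDerivAt (fun x => Real.exp (-‖x‖ ^ 2))
      (Real.exp (-‖x‖ ^ 2) • -(∑ i, evalAt x (pderiv i (normSq d)) •
        (EuclideanSpace.proj i : EuclideanSpace ℝ (Fin d) →L[ℝ] ℝ))) x := by
    intro x
    simp only [← evalAt_normSq]
    exact (hasFDerivAt_evalAt (normSq d) x).neg.exp
  have hE' : ∀ x : EuclideanSpace ℝ (Fin d), fderiv ℝ (fun x => Real.exp (-‖x‖ ^ 2)) x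
      (EuclideanSpace.single i 1) = -2 * (Real.exp (-‖x‖ ^ 2) * evalAt x (X i)) := by
    intro x
    rw [(hE x).fderiv, smul_apply, neg_apply,
      sum_smul_proj_single, pderiv_normSq, evalAt_mul]
    simp [evalAt]
    ring
  have hF' : ∀ x : EuclideanSpace ℝ (Fin d), fderiv ℝ (fun x => evalAt x f) x
      (EuclideanSpace.single i 1) = evalAt x (pderiv i f) := by
    intro x
    rw [(hasFDerivAt_evalAt f x).fderiv, sum_smul_proj_single]
  have h := integral_mul_fderiv_eq_neg_fderiv_mul_of_integrable (μ := volume)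
    (f := fun x : EuclideanSpace ℝ (Fin d) => Real.exp (-‖x‖ ^ 2)) (g := fun x => evalAt x f)
    (v := EuclideanSpace.single i 1) ?_ ?_ (integrable_gauss f)
    (fun x _ => (hE x).differentiableAt) (fun x _ => (hasFDerivAt_evalAt f x).differentiableAt)
  · simp only [hE', hF'] at h
    unfold gaussInt
    rw [h, ← integral_const_mul, ← integral_neg]
    congr 1
    funext x
    rw [evalAt_mul]; ring
  · simp only [hE']
    have := (integrable_gauss (X i * f)).const_mul (-2)
    refine this.congr (Filter.Eventually.of_forall fun x => ?_)
    simp only [evalAt_mul]; ring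
  · simp only [hF']
    exact integrable_gauss _

/-- The radial factor of the Gaussian integral of a homogeneous polynomial of degree `k`. -/
def gaussMoment (d k : ℕ) : ℝ :=
  ∫ r in Ioi (0 : ℝ), r ^ (d - 1) * (Real.exp (-r ^ 2) * r ^ k)

theorem gaussMoment_pos (d k : ℕ) : 0 < gaussMoment d k := by
  have hq : (-1 : ℝ) < ((d - 1 + k : ℕ) : ℝ) := by
    linarith [((d - 1 + k).cast_nonneg : (0 : ℝ) ≤ ((d - 1 + k : ℕ) : ℝ))]
  have h := integral_rpow_mul_exp_neg_mul_rpow two_pos hq one_pos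
  have : gaussMoment d k = ∫ x in Ioi (0 : ℝ), x ^ ((d - 1 + k : ℕ) : ℝ) *
      Real.exp (-1 * x ^ (2 : ℝ)) := by
    unfold gaussMoment
    congr 1
    funext x
    rw [Real.rpow_natCast, Real.rpow_two, pow_add, neg_one_mul]; ring
  rw [this, h]
  have := Real.Gamma_pos_of_pos (s := (((d - 1 + k : ℕ) : ℝ) + 1) / 2) (by linarith)
  simp only [Real.one_rpow]
  positivity

theorem gaussInt_of_isHomogeneous (hd : 1 ≤ d) {f : Poly d} {k : ℕ} (hf : f.IsHomogeneous k) :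
    gaussInt f = gaussMoment d k * sphereInt f :=
  integral_radial_mul_evalAt hd hf fun r => Real.exp (-r ^ 2)

/-- The polynomial `∇f · ∇g`. -/
def gradDotPoly (f g : Poly d) : Poly d := ∑ i, pderiv i f * pderiv i g

theorem gradDotPoly_comm (f g : Poly d) : gradDotPoly f g = gradDotPoly g f := by
  simp only [gradDotPoly, mul_comm]

theorem gradIntegral_eq (f g : Poly d) : gradIntegral f g = ballInt (gradDotPoly f g) := by
  simp only [gradIntegral, ballInt, gradDotPoly, evalAt_sum, evalAt_mul, gradDot]

theorem isHomogeneous_gradDotPoly {f g : Poly d} {m l : ℕ} (hf : f.IsHomogeneous m)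
    (hg : g.IsHomogeneous l) : (gradDotPoly f g).IsHomogeneous (m - 1 + (l - 1)) :=
  IsHomogeneous.sum _ _ _ fun _ _ => hf.pderiv.mul hg.pderiv

/-- Since Δz = 0, ∇y·∇z is the divergence of y∇z; integrate by parts and use Euler's identity x·∇z =
l z. -/
theorem gaussInt_gradDotPoly {y z : Poly d} {l : ℕ} (hz : z ∈ harmonicSpace d l) :
    gaussInt (gradDotPoly y z) = 2 * l * gaussInt (y * z) := by
  have h1 : gradDotPoly y z = ∑ i, pderiv i (y * pderiv i z) := by
    have := laplacian_apply z
    rw [LinearMap.mem_ker.1 hz.2] at this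
    simp only [pderiv_mul, Finset.sum_add_distrib, ← Finset.mul_sum, ← this, mul_zero, add_zero,
      gradDotPoly]
  have h2 : ∑ i, X i * (y * pderiv i z) = (l : ℝ) • (y * z) := by
    have := IsHomogeneous.sum_X_mul_pderiv (φ := z) (n := l) hz.1
    rw [← mul_smul_comm, Nat.cast_smul_eq_nsmul, ← this, Finset.mul_sum]
    exact Finset.sum_congr rfl fun i _ => by ring
  rw [h1, gaussInt_sum]
  simp only [gaussInt_pderiv]
  rw [← Finset.mul_sum, ← gaussInt_sum, h2, gaussInt_smul]
  ring

/-- The previous identity has a left side symmetric in y and z, so exchanging them gives (l - m) ∫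
yz = 0. -/
theorem sphereInt_mul_eq_zero (hd : 1 ≤ d) {y z : Poly d} {m l : ℕ} (hy : y ∈ harmonicSpace d m)
    (hz : z ∈ harmonicSpace d l) (hml : m ≠ l) : sphereInt (y * z) = 0 := by
  have h1 := gaussInt_gradDotPoly (y := y) hz
  have h2 := gaussInt_gradDotPoly (y := z) hy
  rw [gradDotPoly_comm, h1, mul_comm z y] at h2
  rw [gaussInt_of_isHomogeneous hd (IsHomogeneous.mul hy.1 hz.1)] at h2
  have h3 := (gaussMoment_pos d (m + l)).ne'
  have h4 : (l : ℝ) - m ≠ 0 := sub_ne_zero.2 (by exact_mod_cast hml.symm)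
  have h5 : ((l : ℝ) - m) * (gaussMoment d (m + l) * sphereInt (y * z)) = 0 := by linarith
  simpa [h3, h4] using h5

/-- Integrate the divergence of the field f(x)x. -/
theorem gaussInt_normSq_mul {f : Poly d} {k : ℕ} (hf : f.IsHomogeneous k) :
    2 * gaussInt (normSq d * f) = (k + d) * gaussInt f := by
  have h1 : ∑ i, pderiv i (X i * f) = ((k : ℝ) + d) • f := by
    have := hf.sum_X_mul_pderiv
    simp only [pderiv_mul, pderiv_X_self, one_mul, Finset.sum_add_distrib, this]
    simp [add_smul, add_comm, Nat.cast_smul_eq_nsmul]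
  have h2 : ∑ i, X i * (X i * f) = normSq d * f := by
    rw [normSq, Finset.sum_mul]
    exact Finset.sum_congr rfl fun i _ => by ring
  rw [← gaussInt_smul (k + d : ℝ) f, ← h1, gaussInt_sum, ← h2, gaussInt_sum, Finset.mul_sum]
  simp only [gaussInt_pderiv]

/-- Multiplying ∇y·∇z by ‖x‖² changes nothing on the sphere but raises the degree to m + l, so both
sides carry the same nonzero Gaussian radial factor, which cancels. -/
theorem sphereInt_gradDotPoly (hd : 1 ≤ d) {y z : Poly d} {m l : ℕ} (hy : y ∈ harmonicSpace d m)
    (hz : z ∈ harmonicSpace d l) (hm : 1 ≤ m) (hl : 1 ≤ l) :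
    sphereInt (gradDotPoly y z) = l * ((m : ℝ) + l - 2 + d) * sphereInt (y * z) := by
  have hD := isHomogeneous_gradDotPoly hy.1 hz.1
  have h1 := gaussInt_gradDotPoly (y := y) hz
  have h2 := gaussInt_normSq_mul hD
  rw [h1, gaussInt_of_isHomogeneous hd (IsHomogeneous.mul hy.1 hz.1),
    gaussInt_of_isHomogeneous hd ((isHomogeneous_normSq d).mul hD), sphereInt_normSq_mul,
    show 2 + (m - 1 + (l - 1)) = m + l by lia] at h2
  have h3 := (gaussMoment_pos d (m + l)).ne'
  have h4 : (((m - 1 + (l - 1) : ℕ) : ℝ)) = m + l - 2 := by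
    rw [Nat.cast_add, Nat.cast_sub hm, Nat.cast_sub hl]; push_cast; ring
  rw [h4] at h2
  apply mul_left_cancel₀ h3
  linarith

theorem ballInt_add (f g : Poly d) : ballInt (f + g) = ballInt f + ballInt g := by
  unfold ballInt
  rw [← integral_add (integrableOn_ball f) (integrableOn_ball g)]
  simp only [evalAt_add]

theorem ballInt_smul (c : ℝ) (f : Poly d) : ballInt (c • f) = c * ballInt f := by
  unfold ballInt
  rw [← integral_const_mul]
  simp only [evalAt_smul]

theorem sphereInt_normSq_pow_mul (j : ℕ) (f : Poly d) :
    sphereInt (normSq d ^ j * f) = sphereInt f := by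
  induction j with
  | zero => simp
  | succ j ih => rw [pow_succ', mul_assoc, sphereInt_normSq_mul, ih]

/-- The exponent and the factor 1/2 come from the substitution s = r² in the radial integral. -/
theorem ballInt_aeval_normSq_mul (hd : 1 ≤ d) (p : Polynomial ℝ) {f : Poly d} {k : ℕ}
    (hf : f.IsHomogeneous k) :
    ballInt (Polynomial.aeval (normSq d) p * f) =
      1 / 2 * moment ((k + d) / 2 - 1) p * sphereInt f := by
  induction p using Polynomial.induction_on' with
  | add p q hp hq => rw [map_add, map_add, add_mul, ballInt_add, hp, hq]; ring
  | monomial n a =>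
    rw [Polynomial.aeval_monomial, moment_monomial, algebraMap_eq, mul_assoc, ← smul_eq_C_mul,
      ballInt_smul, ballInt_of_isHomogeneous hd (((isHomogeneous_normSq d).pow n).mul hf),
      sphereInt_normSq_pow_mul]
    have hd' : (1 : ℝ) ≤ d := by exact_mod_cast hd
    have h1 : (n : ℝ) + ((k + d) / 2 - 1) + 1 = (2 * n + k + d) / 2 := by ring
    have h2 : (2 * n + k + d : ℝ) ≠ 0 := by positivity
    rw [h1]
    push_cast
    field_simp

theorem pderiv_aeval_normSq (p : Polynomial ℝ) (i : Fin d) :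
    pderiv i (Polynomial.aeval (normSq d) p) =
      2 * X i * Polynomial.aeval (normSq d) (Polynomial.derivative p) := by
  rw [Derivation.map_aeval, pderiv_normSq, smul_eq_mul]; ring

theorem gradDotPoly_radial (p q : Polynomial ℝ) {y z : Poly d} {m l : ℕ}
    (hy : y.IsHomogeneous m) (hz : z.IsHomogeneous l) :
    gradDotPoly (Polynomial.aeval (normSq d) p * y) (Polynomial.aeval (normSq d) q * z) =
      Polynomial.aeval (normSq d) (4 * Polynomial.X * Polynomial.derivative p *
        Polynomial.derivative q + Polynomial.C (2 * l : ℝ) * (Polynomial.derivative p * q) +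
        Polynomial.C (2 * m : ℝ) * (p * Polynomial.derivative q)) * (y * z) +
      Polynomial.aeval (normSq d) (p * q) * gradDotPoly y z := by
  have ey : ∑ i, X i * pderiv i y = (m : Poly d) * y := by
    rw [hy.sum_X_mul_pderiv, nsmul_eq_mul]
  have ez : ∑ i, X i * pderiv i z = (l : Poly d) * z := by
    rw [hz.sum_X_mul_pderiv, nsmul_eq_mul]
  have key : ∀ i, pderiv i (Polynomial.aeval (normSq d) p * y) *
      pderiv i (Polynomial.aeval (normSq d) q * z) =
      4 * Polynomial.aeval (normSq d) (Polynomial.derivative p) *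
        Polynomial.aeval (normSq d) (Polynomial.derivative q) * (y * z) * X i ^ 2 +
      2 * Polynomial.aeval (normSq d) (Polynomial.derivative p) *
        Polynomial.aeval (normSq d) q * y * (X i * pderiv i z) +
      2 * Polynomial.aeval (normSq d) p *
        Polynomial.aeval (normSq d) (Polynomial.derivative q) * z * (X i * pderiv i y) +
      Polynomial.aeval (normSq d) p * Polynomial.aeval (normSq d) q *
        (pderiv i y * pderiv i z) := by
    intro i
    simp only [pderiv_mul, pderiv_aeval_normSq]; ring
  rw [gradDotPoly, Finset.sum_congr rfl fun i _ => key i]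
  simp only [Finset.sum_add_distrib, ← Finset.mul_sum]
  rw [ey, ez, ← normSq, ← gradDotPoly]
  simp only [map_add, map_mul, Polynomial.aeval_X, map_ofNat,
    map_natCast]
  ring

end SobolevBall
end

/-! ### The Dirichlet form on radial multiples of harmonics, and definiteness. -/

noncomputable section
namespace SobolevBall
open MeasureTheory Set MvPolynomial

variable {d : ℕ}

theorem moment_X_mul (γ : ℝ) (p : Polynomial ℝ) :
    moment (γ - 1) (Polynomial.X * p) = moment γ p := by
  induction p using Polynomial.induction_on' with
  | add p q hp hq => rw [mul_add, map_add, map_add, hp, hq]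
  | monomial n a =>
    rw [Polynomial.X_mul_monomial, moment_monomial, moment_monomial]
    push_cast; congr 1; ring

/-- Integration by parts on [0,1]; γ > 0 removes the boundary term at 0. -/
theorem moment_derivative_add {γ : ℝ} (hγ : 0 < γ) (p : Polynomial ℝ) :
    moment γ (Polynomial.derivative p) + γ * moment (γ - 1) p = p.eval 1 := by
  induction p using Polynomial.induction_on' with
  | add p q hp hq =>
    rw [Polynomial.derivative_add, map_add, map_add, Polynomial.eval_add, ← hp, ← hq]; ring
  | monomial n a =>
    rw [Polynomial.derivative_monomial, moment_monomial, moment_monomial,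
      Polynomial.eval_monomial, one_pow, mul_one]
    rcases n with _ | n
    · simp
      field_simp
    · have : (0 : ℝ) ≤ n := n.cast_nonneg
      have h : (n : ℝ) + γ + 1 ≠ 0 := by positivity
      push_cast
      rw [show (n : ℝ) + 1 + (γ - 1) + 1 = n + γ + 1 by ring]
      field_simp
      ring

/-- The radial part of the Dirichlet form on products `p(‖x‖²) y` with `y` a solid harmonic of
degree `m`. -/
def radialForm (d m : ℕ) (p q : Polynomial ℝ) : ℝ :=
  m * (p.eval 1 * q.eval 1) +
    2 * moment (m + d / 2) (Polynomial.derivative p * Polynomial.derivative q)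

theorem gradDotPoly_eq_zero {y : Poly d} (hy : y.IsHomogeneous 0) (z : Poly d) :
    gradDotPoly y z = 0 :=
  Finset.sum_eq_zero fun i _ => by rw [pderiv_eq_zero_of_isHomogeneous_zero hy, zero_mul]

/-- For m = l the cross terms form 2m(pq)'; integration by parts against s^{m+d/2-1} absorbs the
term pq ∇y·∇z and leaves only the boundary value m p(1)q(1). -/
theorem gradIntegral_radial (hd : 1 ≤ d) (p q : Polynomial ℝ) {y z : Poly d} {m l : ℕ}
    (hy : y ∈ harmonicSpace d m) (hz : z ∈ harmonicSpace d l) :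
    gradIntegral (Polynomial.aeval (normSq d) p * y) (Polynomial.aeval (normSq d) q * z) =
      radialForm d m p q * sphereInt (y * z) := by
  rw [gradIntegral_eq, gradDotPoly_radial p q hy.1 hz.1, ballInt_add,
    ballInt_aeval_normSq_mul hd _ (IsHomogeneous.mul hy.1 hz.1),
    ballInt_aeval_normSq_mul hd _ (isHomogeneous_gradDotPoly hy.1 hz.1)]
  have hz0 : sphereInt (0 : Poly d) = 0 := by simp [sphereInt, evalAt]
  by_cases hml : m = l
  · subst hml
    have e1 : ((m + m : ℕ) + d : ℝ) / 2 - 1 = (m + d / 2) - 1 := by push_cast; ring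
    have e2 : (4 * Polynomial.X * Polynomial.derivative p * Polynomial.derivative q +
        Polynomial.C (2 * m : ℝ) * (Polynomial.derivative p * q) +
        Polynomial.C (2 * m : ℝ) * (p * Polynomial.derivative q)) =
        Polynomial.C 4 * (Polynomial.X * (Polynomial.derivative p * Polynomial.derivative q)) +
        Polynomial.C (2 * m : ℝ) * Polynomial.derivative (p * q) := by
      rw [Polynomial.derivative_mul, map_ofNat]; ring
    rw [e1, e2, map_add, moment_C_mul, moment_C_mul, moment_X_mul, radialForm]
    -- For m = 0 the exponent m + d/2 - 1 need not be positive, but then y is constant and has no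
    -- gradient.
    rcases Nat.eq_zero_or_pos m with h0 | hm
    · subst h0
      rw [gradDotPoly_eq_zero hy.1, hz0]
      push_cast; ring
    · rw [sphereInt_gradDotPoly hd hy hz hm hm]
      have hm1 : (1 : ℝ) ≤ m := by exact_mod_cast hm
      have hd1 : (1 : ℝ) ≤ d := by exact_mod_cast hd
      have e3 : ((m - 1 + (m - 1) : ℕ) + d : ℝ) / 2 - 1 = (m + d / 2 - 1) - 1 := by
        rw [Nat.cast_add, Nat.cast_sub hm]; push_cast; ring
      have h := moment_derivative_add (γ := m + d / 2 - 1) (by linarith) (p * q)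
      rw [e3, ← Polynomial.eval_mul, ← h]
      ring
  · rw [sphereInt_mul_eq_zero hd hy hz hml]
    have : sphereInt (gradDotPoly y z) = 0 := by
      rcases Nat.eq_zero_or_pos m with h0 | hm
      · subst h0
        rw [gradDotPoly_eq_zero hy.1, hz0]
      rcases Nat.eq_zero_or_pos l with h0 | hl
      · subst h0
        rw [gradDotPoly_comm, gradDotPoly_eq_zero hz.1, hz0]
      rw [sphereInt_gradDotPoly hd hy hz hm hl, sphereInt_mul_eq_zero hd hy hz hml, mul_zero]
    rw [this]; ring

theorem evalAt_aeval_normSq (x : EuclideanSpace ℝ (Fin d)) (p : Polynomial ℝ) :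
    evalAt x (Polynomial.aeval (normSq d) p) = p.eval (‖x‖ ^ 2) := by
  rw [← evalAt_normSq]
  unfold evalAt
  rw [← Polynomial.coe_aeval_eq_eval, ← MvPolynomial.coe_aeval_eq_eval]
  exact (Polynomial.aeval_algHom_apply (MvPolynomial.aeval fun i => x i) (normSq d) p).symm

theorem innerII_radial (hd : 1 ≤ d) (lam : ℝ) (p q : Polynomial ℝ) {y z : Poly d} {m l : ℕ}
    (hy : y ∈ harmonicSpace d m) (hz : z ∈ harmonicSpace d l) :
    innerII lam (Polynomial.aeval (normSq d) p * y) (Polynomial.aeval (normSq d) q * z) =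
      lam * radialForm d m p q * sphereInner y z +
        evalAt 0 (Polynomial.aeval (normSq d) p * y) *
          evalAt 0 (Polynomial.aeval (normSq d) q * z) := by
  rw [innerII, gradIntegral_radial hd p q hy hz, sphereInner_eq]
  ring

theorem sphereInner_eq_zero (hd : 1 ≤ d) {y z : Poly d} {m l : ℕ} (hy : y ∈ harmonicSpace d m)
    (hz : z ∈ harmonicSpace d l) (hml : m ≠ l) : sphereInner y z = 0 := by
  rw [sphereInner_eq, sphereInt_mul_eq_zero hd hy hz hml, mul_zero]

theorem innerII_comm (lam : ℝ) (f g : Poly d) : innerII lam f g = innerII lam g f := by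
  rw [innerII, innerII, gradIntegral_eq, gradIntegral_eq, gradDotPoly_comm, mul_comm (evalAt 0 f)]

/-- The linear functional `⟨·, g⟩_II`. -/
def innerIILeft (lam : ℝ) (g : Poly d) : Poly d →ₗ[ℝ] ℝ where
  toFun f := innerII lam f g
  map_add' f h := innerII_add_left lam f h g
  map_smul' c f := innerII_smul_left lam c f g

theorem eq_zero_of_evalAt_eq_zero_on_ball (hd : 1 ≤ d) {f : Poly d}
    (hf : ∀ x ∈ Metric.ball (0 : EuclideanSpace ℝ (Fin d)) 1, evalAt x f = 0) : f = 0 := by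
  have hd1 : (1 : ℝ) ≤ d := by exact_mod_cast hd
  -- The box (0,1/d)^d lies in the unit ball, as its points satisfy ∑ xᵢ² < d · (1/d), and it is a
  -- product of infinite sets.
  refine funext_set (fun _ => Ioo (0 : ℝ) (1 / d)) (fun _ => Ioo_infinite (by positivity))
    fun x hx => ?_
  rw [map_zero]
  refine hf (WithLp.toLp 2 x) ?_
  rw [mem_ball_zero_iff]
  refine lt_of_pow_lt_pow_left₀ 2 zero_le_one ?_
  rw [EuclideanSpace.real_norm_sq_eq, one_pow]
  have : Nonempty (Fin d) := ⟨⟨0, hd⟩⟩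
  calc ∑ i, (WithLp.toLp 2 x : EuclideanSpace ℝ (Fin d)) i ^ 2 < ∑ _i : Fin d, (1 / d : ℝ) := by
        refine Finset.sum_lt_sum_of_nonempty Finset.univ_nonempty fun i _ => ?_
        obtain ⟨h1, h2⟩ := hx i trivial
        have h3 : (1 / d : ℝ) ≤ 1 := by rw [div_le_one (by positivity)]; exact hd1
        change x i ^ 2 < _
        nlinarith
    _ = 1 := by
        simp
        field_simp

theorem eq_zero_of_pderiv_eq_zero {f : Poly d} (hf : ∀ i, pderiv i f = 0)
    (h0 : evalAt 0 f = 0) : f = 0 := by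
  ext m
  rw [coeff_zero]
  by_cases hm : m = 0
  · subst hm
    have : evalAt 0 f = coeff 0 f := by
      rw [← constantCoeff_eq, constantCoeff, evalAt]
      simp
      rfl
    rw [← this, h0]
  · obtain ⟨i, hi⟩ := Finsupp.ne_iff.1 hm
    have h := coeff_pderiv (i := i) f (m - Finsupp.single i 1)
    have hle : Finsupp.single i 1 ≤ m := by
      rw [Finsupp.single_le_iff]
      exact Nat.one_le_iff_ne_zero.2 hi
    rw [hf, coeff_zero, tsub_add_cancel_of_le hle] at h
    rcases mul_eq_zero.1 h.symm with h | h
    · exact h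
    · exact absurd h (by positivity)

/-- A vanishing Dirichlet integral makes the gradient zero on the open ball by continuity, hence
zero as a polynomial; the value at 0 then removes the remaining constant. -/
theorem eq_zero_of_innerII_self (hd : 1 ≤ d) {lam : ℝ} (hlam : 0 < lam) {f : Poly d}
    (hf : innerII lam f f = 0) : f = 0 := by
  have hA := sphereArea_pos hd
  have hnn : ∀ x : EuclideanSpace ℝ (Fin d), 0 ≤ gradDot f f x := fun x =>
    Finset.sum_nonneg fun i _ => mul_self_nonneg _
  have hI : 0 ≤ gradIntegral f f := integral_nonneg hnn
  have h1 : 0 ≤ lam / sphereArea d * gradIntegral f f := by positivity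
  have h2 := mul_self_nonneg (evalAt 0 f)
  unfold innerII at hf
  have h3 : evalAt 0 f = 0 := mul_self_eq_zero.1 (by linarith)
  have h4 : gradIntegral f f = 0 := by
    have h5 : lam / sphereArea d * gradIntegral f f = 0 := by linarith
    exact (mul_eq_zero.1 h5).resolve_left (by positivity)
  have h5 : gradDot f f =ᵐ[volume.restrict (Metric.closedBall 0 1)] 0 :=
    (integral_eq_zero_iff_of_nonneg hnn (integrableOn_gradDot f f)).1 h4
  have h6 : gradDot f f =ᵐ[volume.restrict (Metric.ball 0 1)] 0 :=
    ae_restrict_of_ae_restrict_of_subset Metric.ball_subset_closedBall h5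
  have hc : Continuous (gradDot f f) := by
    unfold gradDot
    exact continuous_finsetSum _ fun i _ => (continuous_evalAt _).mul (continuous_evalAt _)
  have h7 := Measure.eqOn_open_of_ae_eq h6 Metric.isOpen_ball hc.continuousOn
    continuousOn_const
  refine eq_zero_of_pderiv_eq_zero (fun i => eq_zero_of_evalAt_eq_zero_on_ball hd fun x hx => ?_) h3
  have h8 : gradDot f f x = 0 := h7 hx
  exact mul_self_eq_zero.1
    ((Finset.sum_eq_zero_iff_of_nonneg fun i _ => mul_self_nonneg _).1 h8 i (Finset.mem_univ i))

end SobolevBall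
end

/-! ### The basis: factorisation, orthogonality, spanning and norms. -/

noncomputable section
namespace SobolevBall
open MvPolynomial

variable {d : ℕ}

theorem one_mem_harmonicSpace (d : ℕ) : (1 : Poly d) ∈ harmonicSpace d 0 :=
  ⟨isHomogeneous_one _ _, laplacian_eq_zero_of_lt_two (isHomogeneous_one _ _) two_pos⟩

theorem harmonicSpace_zero (d : ℕ) : harmonicSpace d 0 = Submodule.span ℝ {(1 : Poly d)} := by
  refine le_antisymm (fun f hf => ?_) ?_
  · have h : IsHomogeneous f 0 := hf.1
    rw [← totalDegree_zero_iff_isHomogeneous, totalDegree_eq_zero_iff_eq_C] at h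
    rw [Submodule.mem_span_singleton]
    exact ⟨coeff 0 f, by rw [smul_eq_C_mul, mul_one, ← h]⟩
  · rw [Submodule.span_singleton_le_iff_mem]
    exact one_mem_harmonicSpace d

theorem harmonicDim_zero (d : ℕ) : harmonicDim d 0 = 1 := by
  rw [harmonicDim, harmonicSpace_zero]
  exact finrank_span_singleton one_ne_zero

theorem sphereInner_one (hd : 1 ≤ d) : sphereInner (1 : Poly d) 1 = 1 := by
  have := (sphereArea_pos hd).ne'
  have h : sphereInt (1 : Poly d) = sphereArea d := by
    simp [sphereInt, evalAt, sphereArea]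
  rw [sphereInner_eq, mul_one, h]
  field_simp

/-- The radial factor, as a polynomial in `‖x‖²`, of the basis elements with first index `j`. -/
def radialPart (d n j : ℕ) : Polynomial ℝ :=
  if j = 0 then 1
  else if 2 * j < n then
    (1 - Polynomial.X) * (jacobi (j - 1) 1 ((n : ℝ) - 2 * j + ((d : ℝ) - 2) / 2)).comp
      (2 * Polynomial.X - 1)
  else
    Polynomial.C (4 / ((n : ℝ) + d - 2)) *
      ((jacobi (n / 2) (-1) (((d : ℝ) - 2) / 2)).comp (2 * Polynomial.X - 1)
        - Polynomial.C ((-1) ^ (n / 2) * (ascPochhammer ℝ (n / 2)).eval ((d : ℝ) / 2)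
          / ((n / 2).factorial : ℝ)))

/-- The harmonic factor of the basis element with index `a`. -/
def harmonicPart (Y : ∀ m : ℕ, Fin (harmonicDim d m) → Poly d) (n : ℕ) (a : BasisIndex d n) :
    Poly d :=
  if 2 * (a.1 : ℕ) < n then Y (n - 2 * (a.1 : ℕ)) a.2 else 1

theorem radial_eq_aeval_normSq (q : Polynomial ℝ) :
    radial d q = Polynomial.aeval (normSq d) (q.comp (2 * Polynomial.X - 1)) := by
  have : Polynomial.aeval (normSq d) (2 : Polynomial ℝ) = 2 := map_ofNat _ 2
  rw [Polynomial.aeval_comp, radial, map_sub, map_mul, this, Polynomial.aeval_X, map_one]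

theorem polyU_eq {n j : ℕ} (hj : 2 * j < n) (y : Poly d) :
    polyU n j y = Polynomial.aeval (normSq d) (radialPart d n j) * y := by
  unfold polyU radialPart
  split_ifs
  · simp
  · rw [radial_eq_aeval_normSq]
    simp

theorem radialV_eq {n : ℕ} (hn : 1 ≤ n) (he : Even n) :
    radialV d n = Polynomial.aeval (normSq d) (radialPart d n (n / 2)) * 1 := by
  have h1 : ¬ n / 2 = 0 := by obtain ⟨k, rfl⟩ := he; lia
  have h2 : ¬ 2 * (n / 2) < n := by obtain ⟨k, rfl⟩ := he; lia
  rw [radialPart, if_neg h1, if_neg h2, radialV, radial_eq_aeval_normSq, mul_one, map_mul, map_sub,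
    Polynomial.aeval_C, Polynomial.aeval_C]
  rfl

theorem eq_of_index {n j : ℕ} (h1 : j ≤ n / 2) (h2 : ¬ 2 * j < n) : n = 2 * j := by lia

theorem basisII_eq {n : ℕ} (hn : 1 ≤ n) (Y : ∀ m : ℕ, Fin (harmonicDim d m) → Poly d)
    (a : BasisIndex d n) :
    basisII Y n a = Polynomial.aeval (normSq d) (radialPart d n a.1) * harmonicPart Y n a := by
  unfold basisII harmonicPart
  split_ifs with h
  · exact polyU_eq h _
  · have := eq_of_index (Nat.lt_succ_iff.1 a.1.2) h
    have h2 : n / 2 = (a.1 : ℕ) := by lia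
    rw [radialV_eq hn ⟨a.1, by lia⟩]
    simp only [h2]

theorem harmonicPart_mem {Y : ∀ m : ℕ, Fin (harmonicDim d m) → Poly d}
    (hY : ∀ m : ℕ, IsOrthonormalHarmonicBasis d m (Y m)) (n : ℕ) (a : BasisIndex d n) :
    harmonicPart Y n a ∈ harmonicSpace d (n - 2 * a.1) := by
  unfold harmonicPart
  split_ifs with h
  · rw [← (hY _).span_eq]
    exact Submodule.subset_span ⟨_, rfl⟩
  · rw [show n - 2 * (a.1 : ℕ) = 0 by lia]
    exact one_mem_harmonicSpace d

theorem sphereInner_harmonicPart (hd : 1 ≤ d) {Y : ∀ m : ℕ, Fin (harmonicDim d m) → Poly d}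
    (hY : ∀ m : ℕ, IsOrthonormalHarmonicBasis d m (Y m)) {n : ℕ} (a b : BasisIndex d n) :
    sphereInner (harmonicPart Y n a) (harmonicPart Y n b) = if a = b then 1 else 0 := by
  by_cases hab : a.1 = b.1
  · obtain ⟨j, μ⟩ := a
    obtain ⟨i, ν⟩ := b
    obtain rfl : j = i := hab
    unfold harmonicPart
    by_cases h : 2 * (j : ℕ) < n
    · simp only [if_pos h, (hY _).orthonormal]
      congr 1
      simp
    -- Here 2j = n, so ν has a single value and the harmonic factor is 1.
    · have h0 : harmonicDim d (n - 2 * (j : ℕ)) = 1 := by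
        rw [show n - 2 * (j : ℕ) = 0 by lia, harmonicDim_zero]
      have : Subsingleton (Fin (harmonicDim d (n - 2 * (j : ℕ)))) := by rw [h0]; infer_instance
      rw [Subsingleton.elim μ ν]
      simp only [if_neg h, if_true]
      exact sphereInner_one hd
  · rw [if_neg fun h => hab (by rw [h])]
    refine sphereInner_eq_zero hd (harmonicPart_mem hY n a) (harmonicPart_mem hY n b) fun h => hab ?_
    have ha := a.1.2
    have hb := b.1.2
    ext
    lia

/-- Both kinds of radial factor have derivatives in the same Jacobi family, so one argument treats
them together. -/
theorem derivative_radialPart (hd : 1 ≤ d) {n j : ℕ} (hj : 1 ≤ j) (hjn : 2 * j ≤ n) :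
    Polynomial.derivative (radialPart d n j) =
      Polynomial.C (if 2 * j < n then -(j : ℝ) else 2) *
        shiftedJacobi (j - 1) ((n - 2 * j : ℕ) + d / 2) := by
  have hj1 : ((j - 1 : ℕ) : ℝ) = j - 1 := by rw [Nat.cast_sub hj]; simp
  rw [radialPart, if_neg (by lia), Nat.cast_sub hjn]
  split_ifs with h
  · rw [derivative_one_sub_mul_jacobi, hj1]
    congr 2
    · ring
    · push_cast; ring
  · obtain rfl : n = 2 * j := by lia
    obtain ⟨k, rfl⟩ : ∃ k, j = k + 1 := ⟨j - 1, by lia⟩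
    rw [show 2 * (k + 1) / 2 = k + 1 by lia, Polynomial.derivative_C_mul, Polynomial.derivative_sub,
      Polynomial.derivative_C, sub_zero, derivative_jacobi_neg_one, ← mul_assoc, ← Polynomial.C_mul]
    have hd1 : (1 : ℝ) ≤ d := by exact_mod_cast hd
    have hk : (0 : ℝ) ≤ k := k.cast_nonneg
    have h1 : 2 * (k : ℝ) + d ≠ 0 := by positivity
    congr 2
    · push_cast
      -- The normalisation 4/(n+d-2) cancels the Jacobi derivative factor k + 1 + (d-2)/2 =
      -- (2k+d)/2, leaving 2.
      rw [show 2 * ((k : ℝ) + 1) + d - 2 = 2 * k + d by ring]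
      field_simp
      ring
    · push_cast; ring

theorem derivative_coeff_ne_zero {n j : ℕ} (hj : 1 ≤ j) :
    (if 2 * j < n then -(j : ℝ) else 2) ≠ 0 := by
  have : (0 : ℝ) < j := by exact_mod_cast hj
  split_ifs
  · linarith
  · norm_num

theorem neg_one_lt_weight (d m : ℕ) : (-1 : ℝ) < (m : ℝ) + d / 2 := by
  have : (0 : ℝ) ≤ (m : ℝ) + d / 2 := by positivity
  linarith

theorem natDegree_radialPart_le (hd : 1 ≤ d) {n j : ℕ} (hjn : 2 * j ≤ n) :
    (radialPart d n j).natDegree ≤ j := by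
  rcases Nat.eq_zero_or_pos j with rfl | hj
  · simp [radialPart]
  · have h := congrArg Polynomial.natDegree (derivative_radialPart hd hj hjn)
    rw [Polynomial.natDegree_derivative] at h
    have h2 := Polynomial.natDegree_C_mul_le (if 2 * j < n then -(j : ℝ) else 2)
      (shiftedJacobi (j - 1) ((n - 2 * j : ℕ) + d / 2))
    have h3 := natDegree_shiftedJacobi_le (j - 1) ((n - 2 * j : ℕ) + d / 2)
    lia

theorem coeff_radialPart_ne_zero (hd : 1 ≤ d) {n j : ℕ} (hjn : 2 * j ≤ n) :
    (radialPart d n j).coeff j ≠ 0 := by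
  rcases Nat.eq_zero_or_pos j with rfl | hj
  · simp [radialPart]
  · intro h0
    have h := congrArg (fun p => p.coeff (j - 1)) (derivative_radialPart hd hj hjn)
    simp only [Polynomial.coeff_derivative, Polynomial.coeff_C_mul, Nat.sub_add_cancel hj, h0,
      zero_mul] at h
    exact mul_ne_zero (derivative_coeff_ne_zero hj)
      (coeff_shiftedJacobi_pos (j - 1) (neg_one_lt_weight d (n - 2 * j))).ne' h.symm

theorem degree_mul_eval_one_radialPart {n j : ℕ} (hj : 1 ≤ j) :
    ((n - 2 * j : ℕ) : ℝ) * (radialPart d n j).eval 1 = 0 := by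
  by_cases h : 2 * j < n
  · rw [radialPart, if_neg (by lia), if_pos h]
    simp
  · rw [show n - 2 * j = 0 by lia]
    simp

theorem radialForm_radialPart (hd : 1 ≤ d) {n j : ℕ} (hj : 1 ≤ j) (hjn : 2 * j ≤ n)
    (q : Polynomial ℝ) :
    radialForm d (n - 2 * j) (radialPart d n j) q = 2 * (if 2 * j < n then -(j : ℝ) else 2) *
      moment ((n - 2 * j : ℕ) + d / 2) (Polynomial.derivative q *
        shiftedJacobi (j - 1) ((n - 2 * j : ℕ) + d / 2)) := by
  rw [radialForm, ← mul_assoc, degree_mul_eval_one_radialPart hj, derivative_radialPart hd hj hjn,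
    mul_assoc, moment_C_mul, mul_comm (shiftedJacobi _ _)]
  ring

theorem radialForm_radialPart_X_pow (hd : 1 ≤ d) {n i j : ℕ} (hij : i < j) (hjn : 2 * j ≤ n) :
    radialForm d (n - 2 * j) (radialPart d n j) (Polynomial.X ^ i) = 0 := by
  rw [radialForm_radialPart hd (by lia) hjn, moment_mul_shiftedJacobi (neg_one_lt_weight _ _),
    mul_zero]
  -- The case i = 0 is separate: the derivative is 0, of degree ⊥, which is needed when j = 1.
  rcases i with _ | i
  · rw [pow_zero, Polynomial.derivative_one, Polynomial.degree_zero]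
    exact WithBot.bot_lt_coe _
  · rw [Polynomial.derivative_X_pow]
    refine (Polynomial.degree_C_mul_X_pow_le _ _).trans_lt ?_
    exact_mod_cast (by lia : i + 1 - 1 < j - 1)

theorem radialForm_radialPart_self (hd : 1 ≤ d) {n j : ℕ} (hj : 1 ≤ j) (hjn : 2 * j ≤ n) :
    radialForm d (n - 2 * j) (radialPart d n j) (radialPart d n j) =
      2 * (if 2 * j < n then -(j : ℝ) else 2) ^ 2 /
        (2 * (j - 1 : ℕ) + ((n - 2 * j : ℕ) + d / 2) + 1) := by
  rw [radialForm_radialPart hd hj hjn, derivative_radialPart hd hj hjn, mul_assoc _ (shiftedJacobi _ _),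
    moment_C_mul, moment_shiftedJacobi_sq _ (neg_one_lt_weight _ _)]
  ring

theorem radialForm_radialPart_zero (n : ℕ) :
    radialForm d n (radialPart d n 0) (radialPart d n 0) = n := by
  simp [radialForm, radialPart]

theorem radialForm_radialPart_self_pos (hd : 1 ≤ d) {n j : ℕ} (hn : 1 ≤ n) (hjn : 2 * j ≤ n) :
    0 < radialForm d (n - 2 * j) (radialPart d n j) (radialPart d n j) := by
  rcases Nat.eq_zero_or_pos j with rfl | hj
  · rw [Nat.mul_zero, Nat.sub_zero, radialForm_radialPart_zero]
    exact_mod_cast hn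
  · rw [radialForm_radialPart_self hd hj hjn]
    have := derivative_coeff_ne_zero (n := n) hj
    positivity

theorem evalAt_zero_of_isHomogeneous {f : Poly d} {m : ℕ} (hm : 1 ≤ m) (hf : f.IsHomogeneous m) :
    evalAt 0 f = 0 := by
  have := evalAt_smul_of_isHomogeneous hf 0 0
  rwa [zero_smul, zero_pow (by lia), zero_mul] at this

theorem two_mul_index_le {n : ℕ} (a : BasisIndex d n) : 2 * (a.1 : ℕ) ≤ n := by
  have := a.1.2
  lia

theorem eval_zero_radialPart {j : ℕ} (hj : 1 ≤ j) :
    (radialPart d (2 * j) j).eval 0 = 0 := by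
  rw [radialPart, if_neg (by lia), if_neg (by lia), show 2 * j / 2 = j by lia, Polynomial.eval_mul,
    Polynomial.eval_sub, eval_jacobi_comp_zero, Polynomial.eval_C,
    show ((d : ℝ) - 2) / 2 + 1 = d / 2 by ring, Polynomial.eval_C, sub_self, mul_zero]

theorem evalAt_zero_basisII {Y : ∀ m : ℕ, Fin (harmonicDim d m) → Poly d}
    (hY : ∀ m : ℕ, IsOrthonormalHarmonicBasis d m (Y m)) {n : ℕ} (hn : 1 ≤ n)
    (a : BasisIndex d n) : evalAt 0 (basisII Y n a) = 0 := by
  rw [basisII_eq hn, evalAt_mul]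
  by_cases h : 2 * (a.1 : ℕ) < n
  · rw [evalAt_zero_of_isHomogeneous (by lia) (harmonicPart_mem hY n a).1, mul_zero]
  · have h2 : n = 2 * a.1 := by have := two_mul_index_le a; lia
    rw [evalAt_aeval_normSq, norm_zero, zero_pow two_ne_zero,
      show radialPart d n a.1 = radialPart d (2 * a.1) a.1 by rw [← h2],
      eval_zero_radialPart (by lia), zero_mul]

theorem innerII_basisII (hd : 1 ≤ d) (lam : ℝ) {Y : ∀ m : ℕ, Fin (harmonicDim d m) → Poly d}
    (hY : ∀ m : ℕ, IsOrthonormalHarmonicBasis d m (Y m)) {n : ℕ} (hn : 1 ≤ n)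
    (a : BasisIndex d n) (q : Polynomial ℝ) {z : Poly d} {l : ℕ} (hz : z ∈ harmonicSpace d l) :
    innerII lam (basisII Y n a) (Polynomial.aeval (normSq d) q * z) =
      lam * radialForm d (n - 2 * a.1) (radialPart d n a.1) q *
        sphereInner (harmonicPart Y n a) z := by
  have h := evalAt_zero_basisII hY hn a
  rw [basisII_eq hn] at h ⊢
  rw [innerII_radial hd lam _ q (harmonicPart_mem hY n a) hz, h]
  ring

theorem innerII_basisII_of_ne (hd : 1 ≤ d) (lam : ℝ)
    {Y : ∀ m : ℕ, Fin (harmonicDim d m) → Poly d}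
    (hY : ∀ m : ℕ, IsOrthonormalHarmonicBasis d m (Y m)) {n : ℕ} (hn : 1 ≤ n)
    {a b : BasisIndex d n} (hab : a ≠ b) :
    innerII lam (basisII Y n a) (basisII Y n b) = 0 := by
  rw [basisII_eq hn Y b, innerII_basisII hd lam hY hn a _ (harmonicPart_mem hY n b),
    sphereInner_harmonicPart hd hY, if_neg hab, mul_zero]

theorem innerII_basisII_self (hd : 1 ≤ d) (lam : ℝ)
    {Y : ∀ m : ℕ, Fin (harmonicDim d m) → Poly d}
    (hY : ∀ m : ℕ, IsOrthonormalHarmonicBasis d m (Y m)) {n : ℕ} (hn : 1 ≤ n)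
    (a : BasisIndex d n) :
    innerII lam (basisII Y n a) (basisII Y n a) =
      lam * radialForm d (n - 2 * a.1) (radialPart d n a.1) (radialPart d n a.1) := by
  have h := innerII_basisII hd lam hY hn a (radialPart d n a.1) (harmonicPart_mem hY n a)
  rwa [← basisII_eq hn, sphereInner_harmonicPart hd hY, if_pos rfl, mul_one] at h

theorem aeval_normSq_mul_mem {n j m : ℕ} {q : Polynomial ℝ} (hq : q.degree < j) {y : Poly d}
    (hy : y.IsHomogeneous m) (hn : 2 * j + m = n) :
    Polynomial.aeval (normSq d) q * y ∈ restrictTotalDegree (Fin d) ℝ (n - 1) := by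
  rw [q.as_sum_support_C_mul_X_pow, map_sum, Finset.sum_mul]
  refine Submodule.sum_mem _ fun i hi => ?_
  have hij : i < j := by
    have := (Polynomial.le_degree_of_mem_supp i hi).trans_lt hq
    exact_mod_cast this
  rw [map_mul, Polynomial.aeval_C, map_pow, Polynomial.aeval_X, algebraMap_eq, mul_assoc,
    ← smul_eq_C_mul]
  refine Submodule.smul_mem _ _ ?_
  rw [mem_restrictTotalDegree]
  refine (((isHomogeneous_normSq d).pow i).mul hy).totalDegree_le.trans ?_
  lia

theorem degree_radialPart_sub_lt (hd : 1 ≤ d) {n j : ℕ} (hjn : 2 * j ≤ n) :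
    (radialPart d n j - Polynomial.C ((radialPart d n j).coeff j) * Polynomial.X ^ j).degree <
      (j : WithBot ℕ) := by
  rw [Polynomial.degree_lt_iff_coeff_zero]
  intro m hm
  rw [Polynomial.coeff_sub, Polynomial.coeff_C_mul_X_pow]
  split_ifs with h
  · rw [h, sub_self]
  · rw [Polynomial.coeff_eq_zero_of_natDegree_lt, sub_zero]
    exact (natDegree_radialPart_le hd hjn).trans_lt (by lia)

theorem basisII_eq_add (hd : 1 ≤ d) {Y : ∀ m : ℕ, Fin (harmonicDim d m) → Poly d}
    (hY : ∀ m : ℕ, IsOrthonormalHarmonicBasis d m (Y m)) {n : ℕ} (hn : 1 ≤ n)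
    (a : BasisIndex d n) : ∃ r ∈ restrictTotalDegree (Fin d) ℝ (n - 1),
      basisII Y n a = (radialPart d n a.1).coeff a.1 • (normSq d ^ (a.1 : ℕ) * harmonicPart Y n a)
        + r := by
  have hjn := two_mul_index_le a
  refine ⟨_, aeval_normSq_mul_mem (degree_radialPart_sub_lt hd hjn) (harmonicPart_mem hY n a).1
    (by lia : 2 * (a.1 : ℕ) + (n - 2 * a.1) = n), ?_⟩
  rw [basisII_eq hn, map_sub, map_mul, Polynomial.aeval_C, map_pow, Polynomial.aeval_X,
    algebraMap_eq, smul_eq_C_mul]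
  ring

theorem basisII_mem (hd : 1 ≤ d) (lam : ℝ) {Y : ∀ m : ℕ, Fin (harmonicDim d m) → Poly d}
    (hY : ∀ m : ℕ, IsOrthonormalHarmonicBasis d m (Y m)) {n : ℕ} (hn : 1 ≤ n)
    (a : BasisIndex d n) : basisII Y n a ∈ orthogonalSpaceII d lam n := by
  have hjn := two_mul_index_le a
  refine ⟨?_, fun Q hQ => ?_⟩
  · obtain ⟨r, hr, h⟩ := basisII_eq_add hd hY hn a
    rw [mem_restrictTotalDegree] at hr
    rw [h]
    refine (totalDegree_add _ _).trans (max_le ((totalDegree_smul_le _ _).trans ?_) (by lia))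
    refine (((isHomogeneous_normSq d).pow _).mul (harmonicPart_mem hY n a).1).totalDegree_le.trans ?_
    lia
  · have : Q ∈ LinearMap.ker (innerIILeft lam (basisII Y n a)) := by
      refine mem_of_totalDegree_lt hd _ n (fun i m him h hh => ?_) hQ
      rw [LinearMap.mem_ker]
      change innerII lam _ _ = 0
      have e : normSq d ^ i = Polynomial.aeval (normSq d) (Polynomial.X ^ i : Polynomial ℝ) := by
        simp
      rw [innerII_comm, e, innerII_basisII hd lam hY hn a _ hh]
      -- If the harmonic degrees agree, 2i + m < n forces i < j and the radial form vanishes;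
      -- otherwise the sphere integral does.
      by_cases hm : n - 2 * (a.1 : ℕ) = m
      · rw [radialForm_radialPart_X_pow hd (by lia) hjn]; ring
      · rw [sphereInner_eq_zero hd (harmonicPart_mem hY n a) hh hm, mul_zero]
    rw [innerII_comm]
    exact LinearMap.mem_ker.1 this

theorem harmonicSpace_le_span {Y : ∀ m : ℕ, Fin (harmonicDim d m) → Poly d}
    (hY : ∀ m : ℕ, IsOrthonormalHarmonicBasis d m (Y m)) {n : ℕ} (j : Fin (n / 2 + 1)) :
    harmonicSpace d (n - 2 * j) ≤
      Submodule.span ℝ (Set.range fun ν => harmonicPart Y n ⟨j, ν⟩) := by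
  by_cases h : 2 * (j : ℕ) < n
  · simp only [harmonicPart, if_pos h]
    exact (hY _).span_eq.ge
  · have h0 : n - 2 * (j : ℕ) = 0 := by lia
    have h1 : 0 < harmonicDim d (n - 2 * (j : ℕ)) := by rw [h0, harmonicDim_zero]; exact one_pos
    simp only [harmonicPart, if_neg h]
    have h2 : harmonicSpace d (n - 2 * (j : ℕ)) = Submodule.span ℝ {(1 : Poly d)} := by
      rw [h0, harmonicSpace_zero]
    rw [h2, Submodule.span_singleton_le_iff_mem]
    exact Submodule.subset_span ⟨⟨0, h1⟩, rfl⟩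

theorem mem_span_basisII_sup (hd : 1 ≤ d) {Y : ∀ m : ℕ, Fin (harmonicDim d m) → Poly d}
    (hY : ∀ m : ℕ, IsOrthonormalHarmonicBasis d m (Y m)) {n : ℕ} (hn : 1 ≤ n) {P : Poly d}
    (hP : P.totalDegree ≤ n) : P ∈ Submodule.span ℝ (Set.range (basisII Y n)) ⊔
      restrictTotalDegree (Fin d) ℝ (n - 1) := by
  set W := Submodule.span ℝ (Set.range (basisII Y n)) ⊔ restrictTotalDegree (Fin d) ℝ (n - 1)
  rw [← sum_homogeneousComponent P]
  refine W.sum_mem fun i hi => ?_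
  have hi : i ≤ n := by have := Finset.mem_range.1 hi; lia
  have hc := homogeneousComponent_isHomogeneous i P
  rcases hi.lt_or_eq with hi | rfl
  · refine Submodule.mem_sup_right ?_
    rw [mem_restrictTotalDegree]
    exact hc.totalDegree_le.trans (by lia)
  · refine mem_of_isHomogeneous hd W i (fun j m hjm h hh => ?_) hc
    obtain rfl : m = i - 2 * j := by lia
    have hj : j < i / 2 + 1 := by lia
    suffices harmonicSpace d (i - 2 * j) ≤ W.comap (LinearMap.mulLeft ℝ (normSq d ^ j)) from
      this hh
    refine (harmonicSpace_le_span hY ⟨j, hj⟩).trans (Submodule.span_le.2 ?_)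
    rintro _ ⟨ν, rfl⟩
    obtain ⟨r, hr, h⟩ := basisII_eq_add hd hY hn ⟨⟨j, hj⟩, ν⟩
    change normSq d ^ j * _ ∈ W
    -- The leading coefficient is nonzero, so ‖x‖^{2j} y is recovered from the basis element modulo
    -- lower degree.
    rw [← W.smul_mem_iff (coeff_radialPart_ne_zero hd (by lia : 2 * j ≤ i))]
    have h2 := eq_sub_of_add_eq h.symm
    refine Eq.mp (congrArg (· ∈ W) h2.symm) ?_
    exact W.sub_mem (Submodule.mem_sup_left (Submodule.subset_span ⟨_, rfl⟩))
      (Submodule.mem_sup_right hr)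

theorem span_basisII (hd : 1 ≤ d) {lam : ℝ} (hlam : 0 < lam)
    {Y : ∀ m : ℕ, Fin (harmonicDim d m) → Poly d}
    (hY : ∀ m : ℕ, IsOrthonormalHarmonicBasis d m (Y m)) {n : ℕ} (hn : 1 ≤ n) :
    Submodule.span ℝ (Set.range (basisII Y n)) = orthogonalSpaceII d lam n := by
  have hle : Submodule.span ℝ (Set.range (basisII Y n)) ≤ orthogonalSpaceII d lam n := by
    rw [Submodule.span_le]
    rintro _ ⟨a, rfl⟩
    exact basisII_mem hd lam hY hn a
  refine le_antisymm hle fun P hP => ?_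
  obtain ⟨v, hv, w, hw, rfl⟩ := Submodule.mem_sup.1 (mem_span_basisII_sup hd hY hn hP.1)
  have hw2 : w ∈ orthogonalSpaceII d lam n := by
    have := Submodule.sub_mem _ hP (hle hv)
    rwa [add_sub_cancel_left] at this
  rw [mem_restrictTotalDegree] at hw
  -- The remainder w has degree at most n - 1 < n and is orthogonal to all such polynomials, itself
  -- included.
  rw [eq_zero_of_innerII_self hd hlam (hw2.2 w (by lia)), add_zero]
  exact hv

theorem linearIndependent_basisII (hd : 1 ≤ d) {lam : ℝ} (hlam : 0 < lam)
    {Y : ∀ m : ℕ, Fin (harmonicDim d m) → Poly d}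
    (hY : ∀ m : ℕ, IsOrthonormalHarmonicBasis d m (Y m)) {n : ℕ} (hn : 1 ≤ n) :
    LinearIndependent ℝ (basisII Y n) := by
  rw [Fintype.linearIndependent_iff]
  intro c hc a
  have h := congrArg (innerIILeft lam (basisII Y n a)) hc
  rw [map_sum, map_zero, Finset.sum_eq_single a, map_smul, smul_eq_mul] at h
  · refine (mul_eq_zero.1 h).resolve_right ?_
    change innerII lam _ _ ≠ 0
    rw [innerII_basisII_self hd lam hY hn]
    have := radialForm_radialPart_self_pos hd hn (two_mul_index_le a)
    positivity
  · intro b _ hb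
    rw [map_smul]
    change _ • innerII lam _ _ = 0
    rw [innerII_basisII_of_ne hd lam hY hn hb, smul_zero]
  · exact fun h => absurd (Finset.mem_univ a) h

/-- The forms share the gradient term, and both extra terms vanish: 1 - ‖x‖² is zero on the sphere,
and y is zero at the origin. -/
theorem innerII_polyU_eq_innerI (lam : ℝ) {n j : ℕ} (hj : 1 ≤ j) (hjn : 2 * j < n) {y : Poly d}
    (hy : y ∈ harmonicSpace d (n - 2 * j)) :
    innerII lam (polyU n j y) (polyU n j y) = innerI lam (polyU n j y) (polyU n j y) := by
  have h0 : evalAt 0 (polyU n j y) = 0 := by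
    rw [polyU_eq hjn, evalAt_mul, evalAt_zero_of_isHomogeneous (by lia) hy.1, mul_zero]
  have h1 : sphereInner (polyU n j y) (polyU n j y) = 0 := by
    have : ∀ x : Metric.sphere (0 : EuclideanSpace ℝ (Fin d)) 1,
        evalAt x.1 (polyU n j y) = 0 := by
      intro x
      have h2 : evalAt x.1 (1 - normSq d) = 0 := by
        have : evalAt x.1 (1 - normSq d) = 1 - evalAt x.1 (normSq d) := by simp [evalAt]
        rw [this, evalAt_normSq, norm_eq_of_mem_sphere]
        norm_num
      rw [polyU, if_neg (by lia), evalAt_mul, evalAt_mul, h2, zero_mul, zero_mul]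
    simp [sphereInner, this]
  rw [innerII, innerI, h0, h1, mul_zero]

theorem innerII_radialV (hd : 1 ≤ d) (lam : ℝ) {n : ℕ} (hn : 1 ≤ n) (he : Even n) :
    innerII lam (radialV d n) (radialV d n) = 8 * lam / ((n : ℝ) + ((d : ℝ) - 2) / 2) := by
  rw [radialV_eq hn he]
  obtain ⟨k, rfl⟩ := he
  rw [← two_mul, show 2 * k / 2 = k by lia,
    innerII_radial hd lam _ _ (one_mem_harmonicSpace d) (one_mem_harmonicSpace d), evalAt_mul,
    evalAt_aeval_normSq, norm_zero, zero_pow two_ne_zero, eval_zero_radialPart (by lia),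
    sphereInner_one hd]
  have h := radialForm_radialPart_self hd (by lia : 1 ≤ k) (le_refl (2 * k))
  rw [Nat.sub_self, if_neg (lt_irrefl _), Nat.cast_sub (by lia : 1 ≤ k)] at h
  rw [h]
  push_cast
  rw [show 2 * ((k : ℝ) - 1) + (0 + d / 2) + 1 = 2 * k + (d - 2) / 2 by ring]
  ring

end SobolevBall

end

theorem mainTheorem2 (d : ℕ) (hd : 1 ≤ d) (lam : ℝ) (hlam : 0 < lam) (n : ℕ) (hn : 1 ≤ n)
    (Y : ∀ m : ℕ, Fin (SobolevBall.harmonicDim d m) → SobolevBall.Poly d)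
    (hY : ∀ m : ℕ, SobolevBall.IsOrthonormalHarmonicBasis d m (Y m)) :
    -- the family is a basis of the space of orthogonal polynomials of degree `n`
    LinearIndependent ℝ (SobolevBall.basisII Y n) ∧
    Submodule.span ℝ (Set.range (SobolevBall.basisII Y n)) =
      SobolevBall.orthogonalSpaceII d lam n ∧
    -- it is mutually orthogonal
    (∀ a b : SobolevBall.BasisIndex d n, a ≠ b →
      SobolevBall.innerII lam (SobolevBall.basisII Y n a) (SobolevBall.basisII Y n b) = 0) ∧
    -- for even `n` there is exactly one index `(n/2, ν)`
    (Even n → SobolevBall.harmonicDim d (n - 2 * (n / 2)) = 1) ∧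
    -- the norms for `1 ≤ j ≤ ⌊(n-1)/2⌋`
    (∀ a : SobolevBall.BasisIndex d n, 1 ≤ (a.1 : ℕ) → 2 * (a.1 : ℕ) < n →
      SobolevBall.innerII lam (SobolevBall.basisII Y n a) (SobolevBall.basisII Y n a) =
        SobolevBall.innerI lam
          (SobolevBall.polyU n a.1 (Y (n - 2 * (a.1 : ℕ)) a.2))
          (SobolevBall.polyU n a.1 (Y (n - 2 * (a.1 : ℕ)) a.2))) ∧
    -- the norms for `j = 0`
    (∀ a : SobolevBall.BasisIndex d n, (a.1 : ℕ) = 0 → 2 * (a.1 : ℕ) < n →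
      SobolevBall.innerII lam (SobolevBall.basisII Y n a) (SobolevBall.basisII Y n a) =
        n * lam) ∧
    -- the norm of the radial element
    (Even n →
      SobolevBall.innerII lam (SobolevBall.radialV d n) (SobolevBall.radialV d n) =
        8 * lam / ((n : ℝ) + ((d : ℝ) - 2) / 2)) := by
  refine ⟨SobolevBall.linearIndependent_basisII hd hlam hY hn,
    SobolevBall.span_basisII hd hlam hY hn,
    fun a b hab => SobolevBall.innerII_basisII_of_ne hd lam hY hn hab, fun he => ?_,
    fun a h1 h2 => ?_, fun a h0 _ => ?_, SobolevBall.innerII_radialV hd lam hn⟩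
  · have h : n - 2 * (n / 2) = 0 := by obtain ⟨k, rfl⟩ := he; lia
    rw [h, SobolevBall.harmonicDim_zero]
  · have h := SobolevBall.harmonicPart_mem hY n a
    rw [SobolevBall.harmonicPart, if_pos h2] at h
    rw [SobolevBall.basisII, if_pos h2]
    exact SobolevBall.innerII_polyU_eq_innerI lam h1 h2 h
  · rw [SobolevBall.innerII_basisII_self hd lam hY hn, h0, Nat.mul_zero, Nat.sub_zero,
      SobolevBall.radialForm_radialPart_zero, mul_comm]
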